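/- Let $U\subseteq\mathbb R^2$ be an open set of values of the dependent variables $(u,v)$ such that for every $c$ the slice $\{t : (t,c)\in U\}$ is connected (or empty), and let $f:U\to\mathbb R$ be smooth. Fields are smooth functions $(u,v)$ of two independent variables $(x,y)$, periodic in $x$ and $y$ with period 1, with values in $U$. Consider the differential operators $$P_1=\begin{pmatrix}1&0\\0&0\end{pmatrix}\frac{d}{dx}+\begin{pmatrix}v&0\\0&0\end{pmatrix}\frac{d}{dy}+\begin{pmatrix}\frac12 v_y&0\\0&0\end{pmatrix},$$ $$P_2=\begin{pmatrix}1&0\\0&0\end{pmatrix}\frac{d}{dx}+\begin{pmatrix}v&0\\0&0\end{pmatrix}\frac{d}{dy}+\begin{pmatrix}\frac12 v_y&-\frac{v_x+v\,v_y}{u}\\ \frac{v_x+v\,v_y}{u}&0\end{pmatrix},\qquad \omega=\begin{pmatrix}0&f(u,v)\\-f(u,v)&0\end{pmatrix}.$$ An operator $P=(P^{ij})$ is called Hamiltonian if the bracket $\{K,H\}=\int \frac{\delta K}{\delta u^i}P^{ij}\frac{\delta H}{\delta u^j}\,dx\,dy$ (integral over a period cell, $(u^1,u^2)=(u,v)$)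 is skew-symmetric and satisfies the Jacobi identity $\{\{K,G\},H\}+\{\{G,H\},K\}+\{\{H,K\},G\}=0$ for all local functionals $K,G,H$, that is, functionals $\int L\,dx\,dy$ whose density $L$ is a smooth function of $x,y$ (periodic), $u,v$ and finitely many of their partial derivatives. Then: 1. $P_1+\omega$ is Hamiltonian if and only if there is a smooth function $F$ of one variable with $f(u,v)=F(v)$ on $U$. 2. If $u\neq 0$ on $U$, then $P_2+\omega$ is Hamiltonian if and only if there is a smooth function $F$ of one variable with $f(u,v)=F(v)/u$ on $U$. -/

import Mathlib

open scoped ContDiff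

noncomputable section

namespace HydroHam

/-- The plane of the two independent variables `(x, y) = (p 0, p 1)`. -/
abbrev Plane := Fin 2 → ℝ

/-- The space of the values of `n` dependent variables. -/
abbrev State (n : ℕ) := Fin n → ℝ

/-- `n` functions of `(x, y)`. -/
abbrev Profile (n : ℕ) := Plane → State n

/-- The partial derivative along the independent variable with index `α`. -/
def pd (α : Fin 2) (h : Plane → ℝ) : Plane → ℝ :=
  fun p => fderiv ℝ h p (Pi.single α 1)

/-- Invariance under the unit translations along both independent variables. -/
def Periodic {E : Type} (h : Plane → E) : Prop :=
  ∀ (α : Fin 2) (p : Plane), h (p + Pi.single α 1) = h p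

/-- The period cell `[0, 1] × [0, 1]`. -/
def cell : Set Plane := Set.Icc 0 1

/-- Smooth doubly periodic profiles: the admissible variations of a field. -/
def IsVariation {n : ℕ} (η : Profile n) : Prop :=
  ContDiff ℝ ∞ η ∧ Periodic η

/-- Field configurations: smooth doubly periodic profiles with values in `U`. -/
def IsField {n : ℕ} (U : Set (State n)) (q : Profile n) : Prop :=
  ContDiff ℝ ∞ q ∧ Periodic q ∧ ∀ p, q p ∈ U

/-- Jet coordinates: `J i a c` stands for the derivative of the `i`-th dependent variable taken
`a` times along `x` and `c` times along `y`, for `a, c ≤ k`. -/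
abbrev Jet (n k : ℕ) := Fin n → Fin (k + 1) → Fin (k + 1) → ℝ

/-- The jet of a profile at a point. -/
def jet {n : ℕ} (k : ℕ) (q : Profile n) (p : Plane) : Jet n k :=
  fun i a c => ((pd 0)^[(a : ℕ)] ((pd 1)^[(c : ℕ)] (fun p' => q p' i))) p

/-- A functional of the field (only its values on fields matter). -/
abbrev Functional (n : ℕ) := Profile n → ℝ

/-- Local functionals `∫ L(x, y, q, q_x, q_y, …) dx dy`, where the density `L` is smooth, periodic
in `(x, y)`, and depends on finitely many derivatives of the field, of arbitrary order. -/
def IsLocal {n : ℕ} (U : Set (State n)) (F : Functional n) : Prop :=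
  ∃ (k : ℕ) (L : Plane × Jet n k → ℝ),
    ContDiffOn ℝ ∞ L {z | (fun i => z.2 i 0 0) ∈ U} ∧
    (∀ (α : Fin 2) (p : Plane) (J : Jet n k), L (p + Pi.single α 1, J) = L (p, J)) ∧
    ∀ q, IsField U q → F q = ∫ p in cell, L (p, jet k q p)

/-- `φ` is the variational derivative `δK/δq` at `q`: it is smooth and periodic, and
`d/dε K(q + ε η) = ∫ ∑ i, φ i * η i` at `ε = 0`, for all variations `η`. -/
def HasVarDeriv {n : ℕ} (K : Functional n) (q φ : Profile n) : Prop :=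
  IsVariation φ ∧ ∀ η, IsVariation η →
    HasDerivAt (fun ε : ℝ => K (q + ε • η)) (∫ p in cell, ∑ i, φ p i * η p i) 0

open Classical in
/-- The variational derivative of `K` at `q`. It is unique when it exists, and it exists for local
functionals and for their brackets with respect to operators with smooth coefficients. -/
def varDeriv {n : ℕ} (K : Functional n) (q : Profile n) : Profile n :=
  if h : ∃ φ, HasVarDeriv K q φ then h.choose else 0

/-- Differential operators `g^{ijα} d/dx^α + b_k^{ijα} u_α^k + w^{ij}`, a first-order operator of
hydrodynamic type plus an ultralocal one, in two independent and `n` dependent variables. The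
coefficients are functions of the dependent variables. -/
structure Operator (n : ℕ) where
  /-- the coefficient `g^{ijα}` is `g α i j` -/
  g : Fin 2 → Fin n → Fin n → State n → ℝ
  /-- the coefficient `b_k^{ijα}` is `b α k i j` -/
  b : Fin 2 → Fin n → Fin n → Fin n → State n → ℝ
  /-- the coefficient `w^{ij}` is `w i j` -/
  w : Fin n → Fin n → State n → ℝ

/-- The operator, with coefficients evaluated along `q`, applied to `ψ`. -/
def Operator.app {n : ℕ} (P : Operator n) (q ψ : Profile n) : Profile n := fun p i =>
  ∑ j, ((∑ α, P.g α i j (q p) * pd α (fun p' => ψ p' j) p)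
    + (∑ α, ∑ k, P.b α k i j (q p) * pd α (fun p' => q p' k) p) * ψ p j
    + P.w i j (q p) * ψ p j)

/-- The bracket `{K, H} = ∫ δK/δq^i P^{ij} δH/δq^j dx dy`. -/
def bracket {n : ℕ} (P : Operator n) (K H : Functional n) : Functional n := fun q =>
  ∫ p in cell, ∑ i, varDeriv K q p i * P.app q (varDeriv H q) p i

/-- The operator `P` is Hamiltonian on the fields with values in `U`: its bracket of local
functionals is skew-symmetric and satisfies the Jacobi identity. -/
def IsHamiltonian {n : ℕ} (U : Set (State n)) (P : Operator n) : Prop :=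
  (∀ F G, IsLocal U F → IsLocal U G →
    ∀ q, IsField U q → bracket P F G q = -bracket P G F q) ∧
  (∀ F G H, IsLocal U F → IsLocal U G → IsLocal U H →
    ∀ q, IsField U q →
      bracket P (bracket P F G) H q + bracket P (bracket P G H) F q
        + bracket P (bracket P H F) G q = 0)

/-- A first-order operator of hydrodynamic type plus the ultralocal operator `W`. -/
def Operator.addUltralocal {n : ℕ} (P : Operator n) (W : Fin n → Fin n → State n → ℝ) :
    Operator n where
  g := P.g
  b := P.b
  w := fun i j s => P.w i j s + W i j s

/-- `P₁`, with `u = s 0` and `v = s 1`: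
`[[1, 0], [0, 0]] d/dx + [[v, 0], [0, 0]] d/dy + [[v_y / 2, 0], [0, 0]]`. -/
def P₁ : Operator 2 where
  g := fun α i j s =>
    (![!![1, 0; 0, 0], !![s 1, 0; 0, 0]] : Fin 2 → Matrix (Fin 2) (Fin 2) ℝ) α i j
  b := fun α k i j _ =>
    (![![0, 0], ![0, !![1 / 2, 0; 0, 0]]] : Fin 2 → Fin 2 → Matrix (Fin 2) (Fin 2) ℝ) α k i j
  w := fun _ _ _ => 0

/-- `P₂`, with `u = s 0` and `v = s 1`: `[[1, 0], [0, 0]] d/dx + [[v, 0], [0, 0]] d/dy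
+ [[v_y / 2, -(v_x + v v_y) / u], [(v_x + v v_y) / u, 0]]`. -/
def P₂ : Operator 2 where
  g := fun α i j s =>
    (![!![1, 0; 0, 0], !![s 1, 0; 0, 0]] : Fin 2 → Matrix (Fin 2) (Fin 2) ℝ) α i j
  b := fun α k i j s =>
    (![![0, !![0, -(1 / s 0); 1 / s 0, 0]],
       ![0, !![1 / 2, -(s 1 / s 0); s 1 / s 0, 0]]] :
      Fin 2 → Fin 2 → Matrix (Fin 2) (Fin 2) ℝ) α k i j
  w := fun _ _ _ => 0

/-- The ultralocal operator `[[0, f], [-f, 0]]`. -/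
def ultralocal (f : State 2 → ℝ) : Fin 2 → Fin 2 → State 2 → ℝ := fun i j s =>
  (!![0, f s; -f s, 0] : Matrix (Fin 2) (Fin 2) ℝ) i j

end HydroHam

end

/-!
Both operators belong to the family `[[D + v_y / 2, h], [-h, 0]]` with `D = ∂_x + v ∂_y` and
`h = f + m D v` (`hydroOp m f`): `m = 0` for `P₁`, and `m = -1 / u` for `P₂`. In both cases
`m_u = m²`, and for such `m` the operator is Hamiltonian if and only if `f_u = m f`
(`isHamiltonian_hydroOp_iff`). On connected slices `v = const` this says that `f`, respectively
`u f`, is a function of `v` alone (`exists_eq_comp_snd_iff`).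

Skew-symmetry holds for all `m` and `f`, by integration by parts on the torus. For the Jacobi
identity, let `φ`, `ψ`, `χ` be the variational derivatives of `F`, `G`, `H`. The derivative of
`{F, G} = ∫ φ · P ψ` along `η` consists of two terms in which `φ` or `ψ` is differentiated and of
`∫ φ · P'_η ψ`, where `P'_η` is the derivative of the coefficients of `P`
(`hasDerivAt_pairing_app`). For `η = P χ` the terms of the first kind cancel in the cyclic sum,
because second variations are symmetric (`isGradient_euler`) and `P` is skew-symmetric. The cyclic
sum of the remaining terms is the integral of the total derivative
`-(3/2) ∂_y (h φ₀ ψ₀ χ₀)` and of `(f_u - m f)` times the cyclic sum of `(D χ₀) (φ₀ ψ₁ - φ₁ ψ₀)`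
(`integral_cyclic_coeffVar`). Hence `f_u = m f` suffices; that it is necessary is seen at constant
fields from the linear functionals with `φ = (1, 0)`, `ψ = (0, ∂_x sin 2πx)`, `χ = (sin 2πx, 0)`.

The densities and coefficients are smooth only where the field takes its values in `U`. The values
of a field form a compact set, so near a given field they can be multiplied by a cutoff and
replaced by functions that are smooth everywhere (`IsField.exists_cutoff`,
`IsLocal.exists_gradient`); the analysis is then done for globally smooth data. The variational
derivative is unique (`HasVarDeriv.unique`), so it is enough to exhibit one.
-/

noncomputable section

namespace HydroHam

open MeasureTheory Set Filter Topology

/-! ### Smooth functions on the torus -/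

/-- Smooth doubly periodic scalar functions of `(x, y)`, that is, smooth functions on the torus. -/
def TorusFun (h : Plane → ℝ) : Prop := ContDiff ℝ ∞ h ∧ Periodic h

lemma isVariation_iff {n : ℕ} {η : Profile n} :
    IsVariation η ↔ ∀ i, TorusFun (fun p => η p i) := by
  constructor
  · intro h i
    exact ⟨contDiff_pi.1 h.1 i, fun α p => congrFun (h.2 α p) i⟩
  · intro h
    exact ⟨contDiff_pi.2 fun i => (h i).1, fun α p => funext fun i => (h i).2 α p⟩

lemma contDiff_pd {h : Plane → ℝ} (hh : ContDiff ℝ ∞ h) (α : Fin 2) : ContDiff ℝ ∞ (pd α h) :=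
  ((hh.fderiv_right (m := ∞) (by simp)).clm_apply contDiff_const)

lemma contDiff_pd_iterate {h : Plane → ℝ} (hh : ContDiff ℝ ∞ h) (α : Fin 2) (k : ℕ) :
    ContDiff ℝ ∞ ((pd α)^[k] h) := by
  induction k generalizing h with
  | zero => exact hh
  | succ k ih => exact ih (contDiff_pd hh α)

lemma pd_add {g h : Plane → ℝ} (hg : ContDiff ℝ ∞ g) (hh : ContDiff ℝ ∞ h) (α : Fin 2) :
    pd α (fun p => g p + h p) = fun p => pd α g p + pd α h p := by
  funext p
  have h1 := (hg.differentiable (by simp)) p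
  have h2 := (hh.differentiable (by simp)) p
  simp only [pd]
  rw [fderiv_fun_add h1 h2]; rfl

lemma pd_mul {g h : Plane → ℝ} (hg : ContDiff ℝ ∞ g) (hh : ContDiff ℝ ∞ h) (α : Fin 2) :
    pd α (fun p => g p * h p) = fun p => pd α g p * h p + g p * pd α h p := by
  funext p
  have h1 := (hg.differentiable (by simp)) p
  have h2 := (hh.differentiable (by simp)) p
  simp only [pd]
  rw [fderiv_fun_mul h1 h2]
  simp [mul_comm]; ring

lemma pd_neg (h : Plane → ℝ) (α : Fin 2) : pd α (fun p => -h p) = fun p => -pd α h p := by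
  funext p
  simp [pd, fderiv_fun_neg]

lemma pd_const (α : Fin 2) (c : ℝ) : pd α (fun _ => c) = fun _ => 0 := by
  funext p; simp [pd]

lemma pd_const_mul {h : Plane → ℝ} (hh : ContDiff ℝ ∞ h) (α : Fin 2) (c : ℝ) :
    pd α (fun p => c * h p) = fun p => c * pd α h p := by
  rw [pd_mul contDiff_const hh, pd_const]; simp

lemma pd_iterate_add_const_mul {g h : Plane → ℝ} (hg : ContDiff ℝ ∞ g) (hh : ContDiff ℝ ∞ h)
    (α : Fin 2) (c : ℝ) (k : ℕ) :
    (pd α)^[k] (fun p => g p + c * h p) =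
      fun p => (pd α)^[k] g p + c * (pd α)^[k] h p := by
  induction k generalizing g h with
  | zero => rfl
  | succ k ih =>
    simp only [Function.iterate_succ, Function.comp]
    rw [pd_add hg (contDiff_const.mul hh), pd_const_mul hh]
    exact ih (contDiff_pd hg α) (contDiff_pd hh α)

lemma periodic_pd {h : Plane → ℝ} (hh : Periodic h) (α : Fin 2) : Periodic (pd α h) := by
  intro β p
  simp only [pd]
  rw [← fderiv_comp_add_right]
  congr 2
  funext x
  exact hh β x

namespace TorusFun
variable {g h : Plane → ℝ}

lemma pd (hh : TorusFun h) (α : Fin 2) : TorusFun (pd α h) :=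
  ⟨contDiff_pd hh.1 α, periodic_pd hh.2 α⟩

lemma pd_iterate (hh : TorusFun h) (α : Fin 2) (k : ℕ) : TorusFun ((HydroHam.pd α)^[k] h) := by
  induction k generalizing h with
  | zero => exact hh
  | succ k ih => exact ih (hh.pd α)

lemma const (c : ℝ) : TorusFun (fun _ => c) := ⟨contDiff_const, fun _ _ => rfl⟩

lemma add (hg : TorusFun g) (hh : TorusFun h) : TorusFun (fun p => g p + h p) :=
  ⟨hg.1.add hh.1, fun α p => by simp only [hg.2 α p, hh.2 α p]⟩

lemma sub (hg : TorusFun g) (hh : TorusFun h) : TorusFun (fun p => g p - h p) :=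
  ⟨hg.1.sub hh.1, fun α p => by simp only [hg.2 α p, hh.2 α p]⟩

lemma neg (hg : TorusFun g) : TorusFun (fun p => -g p) :=
  ⟨hg.1.neg, fun α p => by simp only [hg.2 α p]⟩

lemma mul (hg : TorusFun g) (hh : TorusFun h) : TorusFun (fun p => g p * h p) :=
  ⟨hg.1.mul hh.1, fun α p => by simp only [hg.2 α p, hh.2 α p]⟩

lemma sum {ι : Type*} {s : Finset ι} {g : ι → Plane → ℝ} (hg : ∀ i ∈ s, TorusFun (g i)) :
    TorusFun (fun p => ∑ i ∈ s, g i p) :=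
  ⟨ContDiff.sum fun i hi => (hg i hi).1,
    fun α p => Finset.sum_congr rfl fun i hi => (hg i hi).2 α p⟩

end TorusFun

/-- A smooth function of a field is a function on the torus. -/
lemma IsVariation.comp {n : ℕ} {q : Profile n} (hq : IsVariation q) {f : State n → ℝ}
    (hf : ContDiff ℝ ∞ f) : TorusFun (fun p => f (q p)) :=
  ⟨hf.comp hq.1, fun α p => by simp only [hq.2 α p]⟩

lemma IsVariation.add_smul {n : ℕ} {q η : Profile n} (hq : IsVariation q) (hη : IsVariation η)
    (s : ℝ) : IsVariation (q + s • η) :=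
  ⟨hq.1.add (contDiff_const.smul hη.1), fun α p => by
    simp only [Pi.add_apply, Pi.smul_apply, hq.2 α p, hη.2 α p]⟩

lemma integrableOn_cell {h : Plane → ℝ} (hh : Continuous h) : IntegrableOn h cell :=
  hh.continuousOn.integrableOn_compact isCompact_Icc

lemma TorusFun.integrableOn {h : Plane → ℝ} (hh : TorusFun h) : IntegrableOn h cell :=
  integrableOn_cell hh.1.continuous

/-! ### Integration over the period cell -/

/-- The integral of a derivative over the period cell vanishes: the contributions of opposite
faces in the divergence theorem cancel by periodicity. -/
lemma integral_pd {h : Plane → ℝ} (hh : TorusFun h) (α : Fin 2) : ∫ p in cell, pd α h p = 0 := by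
  have e : (fun x => ∑ i, (if i = α then fderiv ℝ h x else 0) (Pi.single i 1)) = pd α h := by
    funext x
    rw [Finset.sum_eq_single α] <;> simp +contextual [pd]
  have key := integral_divergence_of_hasFDerivAt_off_countable' (E := ℝ) (n := 1)
    (0 : Fin 2 → ℝ) 1 (fun _ => zero_le_one)
    (fun i p => if i = α then h p else 0)
    (fun i p => if i = α then fderiv ℝ h p else 0) ∅ countable_empty
    (fun i => by
      split_ifs
      · exact hh.1.continuous.continuousOn
      · exact continuousOn_const)
    (fun x _ i => by
      by_cases hi : i = α
      · simpa [hi] using (hh.1.differentiable (by simp) x).hasFDerivAt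
      · simpa [hi] using hasFDerivAt_const (0 : ℝ) x)
    (by
      rw [e]
      exact (hh.pd α).integrableOn)
  rw [e] at key
  rw [cell, key]
  refine Finset.sum_eq_zero fun i _ => ?_
  by_cases hi : i = α
  · subst hi
    rw [sub_eq_zero]
    congr 1
    funext x
    have : (i.insertNth ((1 : Fin 2 → ℝ) i) x : Fin 2 → ℝ)
        = (i.insertNth ((0 : Fin 2 → ℝ) i) x : Fin 2 → ℝ) + Pi.single i 1 := by
      funext j
      refine Fin.succAboveCases i ?_ (fun k => ?_) j
      · simp
      · simp [Fin.succAbove_ne]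
    simp only [if_true]
    rw [this]
    exact hh.2 i _
  · simp [hi]

lemma integral_mul_pd {g h : Plane → ℝ} (hg : TorusFun g) (hh : TorusFun h) (α : Fin 2) :
    ∫ p in cell, g p * pd α h p = -∫ p in cell, pd α g p * h p := by
  have h0 := integral_pd (hg.mul hh) α
  rw [pd_mul hg.1 hh.1, integral_add ((hg.pd α).mul hh).integrableOn
    (hg.mul (hh.pd α)).integrableOn] at h0
  linarith

lemma integral_mul_pd_iterate {g h : Plane → ℝ} (hg : TorusFun g) (hh : TorusFun h) (α : Fin 2)
    (k : ℕ) : ∫ p in cell, g p * (pd α)^[k] h p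
      = (-1) ^ k * ∫ p in cell, (pd α)^[k] g p * h p := by
  induction k generalizing g with
  | zero => simp
  | succ k ih =>
    simp only [Function.iterate_succ_apply' (pd α) k h, Function.iterate_succ_apply]
    rw [integral_mul_pd hg (hh.pd_iterate α k), ih (hg.pd α)]
    ring

/-- Every orbit of the unit translations meets the period cell. -/
lemma Periodic.exists_mem_cell {E : Type} {h : Plane → E} (hh : Periodic h) (p : Plane) :
    ∃ p' ∈ cell, h p' = h p := by
  have hn : ∀ (α : Fin 2) (k : ℕ) (p : Plane), h (p + (k : ℝ) • Pi.single α 1) = h p := by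
    intro α k
    induction k with
    | zero => intro p; simp
    | succ k ih =>
      intro p
      rw [Nat.cast_succ, add_smul, one_smul, ← add_assoc, hh, ih]
  have hz : ∀ (α : Fin 2) (k : ℤ) (p : Plane), h (p + (k : ℝ) • Pi.single α 1) = h p := by
    intro α k p
    obtain ⟨k, rfl | rfl⟩ := k.eq_nat_or_neg
    · simpa using hn α k p
    · rw [← hn α k]
      simp
  refine ⟨p + ((-⌊p 0⌋ : ℤ) : ℝ) • Pi.single 0 1 + ((-⌊p 1⌋ : ℤ) : ℝ) • Pi.single 1 1, ?_, ?_⟩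
  · constructor
    · intro i
      fin_cases i <;> simp [Int.floor_le]
    · intro i
      fin_cases i <;> simp <;> linarith [Int.lt_floor_add_one (p 0), Int.lt_floor_add_one (p 1)]
  · rw [hz, hz]

/-- A nonnegative function on the torus with vanishing integral is zero. -/
lemma TorusFun.eq_zero_of_integral {h : Plane → ℝ} (hh : TorusFun h) (h0 : ∀ p, 0 ≤ h p)
    (hi : ∫ p in cell, h p = 0) (p : Plane) : h p = 0 := by
  rw [setIntegral_eq_zero_iff_of_nonneg_ae (Eventually.of_forall h0) hh.integrableOn] at hi
  have hcl : cell ⊆ closure (interior cell) := by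
    rw [cell, Convex.closure_interior_eq_closure_of_nonempty_interior (𝕜 := ℝ) (convex_Icc _ _)]
    · exact subset_closure
    · refine ⟨fun _ => 1 / 2, ?_⟩
      rw [← pi_univ_Icc, interior_pi_set finite_univ]
      intro i _
      simp only [interior_Icc, Pi.zero_apply, Pi.one_apply]
      norm_num
  have h1 := Measure.eqOn_of_ae_eq hi hh.1.continuous.continuousOn continuousOn_const hcl
  obtain ⟨p', hp', e⟩ := hh.2.exists_mem_cell p
  rw [← e]
  exact h1 hp'

/-! ### Smooth one-parameter families -/

/-- Differentiation under the integral over the period cell. -/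
lemma hasDerivAt_integral_cell {g : ℝ → Plane → ℝ} (hg : ContDiff ℝ ∞ (Function.uncurry g))
    (s : ℝ) : HasDerivAt (fun t => ∫ p in cell, g t p)
      (∫ p in cell, deriv (fun t => g t p) s) s := by
  have hd : ∀ t p, HasDerivAt (fun t => g t p) (deriv (fun t => g t p) t) t := by
    intro t p
    have : ContDiff ℝ ∞ (fun t => g t p) := hg.comp (contDiff_id.prodMk contDiff_const)
    exact (this.differentiable (by simp) t).hasDerivAt
  have hc : Continuous (fun z : ℝ × Plane => deriv (fun t => g t z.2) z.1) := by
    have hsw : ContDiff ℝ ∞ (Function.uncurry fun (z : ℝ × Plane) t => g t z.2) :=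
      hg.comp (contDiff_snd.prodMk (contDiff_snd.comp contDiff_fst))
    exact ((hsw.fderiv (m := ∞) (n := ∞) contDiff_fst (by simp)).clm_apply
      contDiff_const).continuous
  obtain ⟨C, hC⟩ := ((isCompact_Icc (a := s - 1) (b := s + 1)).prod
    (isCompact_Icc (a := (0 : Plane)) (b := 1))).exists_bound_of_continuousOn hc.continuousOn
  have hgt : ∀ t, Continuous (g t) := fun t =>
    (hg.comp (contDiff_const.prodMk contDiff_id)).continuous
  refine (hasDerivAt_integral_of_dominated_loc_of_deriv_le (bound := fun _ => C)
    (s := Icc (s - 1) (s + 1)) (F' := fun t p => deriv (fun t => g t p) t)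
    (Icc_mem_nhds (by linarith) (by linarith))
    (Eventually.of_forall fun t => (hgt t).aestronglyMeasurable)
    (integrableOn_cell (hgt s)) ?_ ?_ ?_ ?_).2
  · exact (hc.comp (continuous_const.prodMk continuous_id)).aestronglyMeasurable
  · filter_upwards [ae_restrict_mem measurableSet_Icc] with p hp t ht
    exact hC (t, p) ⟨ht, hp⟩
  · exact integrableOn_cell continuous_const
  · exact Eventually.of_forall fun p t _ => hd t p

lemma contDiff_pd_param {g : ℝ → Plane → ℝ} (hg : ContDiff ℝ ∞ (Function.uncurry g))
    (α : Fin 2) : ContDiff ℝ ∞ (Function.uncurry fun s => pd α (g s)) := by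
  have : ContDiff ℝ ∞ (Function.uncurry fun (z : ℝ × Plane) p => g z.1 p) :=
    hg.comp ((contDiff_fst.comp contDiff_fst).prodMk contDiff_snd)
  exact (this.fderiv (m := ∞) (n := ∞) contDiff_snd (by simp)).clm_apply contDiff_const

lemma contDiff_pd_iterate_param {g : ℝ → Plane → ℝ} (hg : ContDiff ℝ ∞ (Function.uncurry g))
    (α : Fin 2) (k : ℕ) : ContDiff ℝ ∞ (Function.uncurry fun s => (pd α)^[k] (g s)) := by
  induction k generalizing g with
  | zero => exact hg
  | succ k ih => exact ih (contDiff_pd_param hg α)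

lemma contDiff_deriv_param {g : ℝ → Plane → ℝ} (hg : ContDiff ℝ ∞ (Function.uncurry g))
    (s : ℝ) : ContDiff ℝ ∞ (fun p => deriv (fun t => g t p) s) := by
  have hsw : ContDiff ℝ ∞ (Function.uncurry fun (p : Plane) t => g t p) :=
    hg.comp (contDiff_snd.prodMk contDiff_fst)
  exact (hsw.fderiv (m := ∞) (n := ∞) contDiff_const (by simp)).clm_apply contDiff_const

lemma TorusFun.deriv_param {g : ℝ → Plane → ℝ} (hg : ContDiff ℝ ∞ (Function.uncurry g))
    (hp : ∀ t, Periodic (g t)) (s : ℝ) : TorusFun (fun p => deriv (fun t => g t p) s) :=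
  ⟨contDiff_deriv_param hg s, fun α p => by simp only [hp _ α p]⟩

/-- Derivatives in the parameter commute with derivatives in `x` and `y`. -/
lemma hasDerivAt_pd_param {g : ℝ → Plane → ℝ} (hg : ContDiff ℝ ∞ (Function.uncurry g))
    (α : Fin 2) (s : ℝ) (p : Plane) :
    HasDerivAt (fun t => pd α (g t) p) (pd α (fun p => deriv (fun t => g t p) s) p) s := by
  have hG : Differentiable ℝ (Function.uncurry g) := hg.differentiable (by simp)
  have hG' : Differentiable ℝ (fderiv ℝ (Function.uncurry g)) :=
    (hg.fderiv_right (m := ∞) (by simp)).differentiable (by simp)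
  have e1 : ∀ t p, fderiv ℝ (g t) p = (fderiv ℝ (Function.uncurry g) (t, p)).comp
      (ContinuousLinearMap.inr ℝ ℝ Plane) := fun t p =>
    ((hG (t, p)).hasFDerivAt.comp p (hasFDerivAt_prodMk_right t p)).fderiv
  have e2 : ∀ t p, deriv (fun t => g t p) t = fderiv ℝ (Function.uncurry g) (t, p) (1, 0) :=
    fun t p => by
    have := ((hG (t, p)).hasFDerivAt.comp t (hasFDerivAt_prodMk_left t p)).hasDerivAt.deriv
    simp only [ContinuousLinearMap.comp_apply, ContinuousLinearMap.inl_apply] at this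
    exact this
  have hsymm : IsSymmSndFDerivAt ℝ (Function.uncurry g) (s, p) :=
    hg.contDiffAt.isSymmSndFDerivAt (by
    simpa using (WithTop.coe_le_coe.2 le_top : ((2 : ℕ∞) : WithTop ℕ∞) ≤ ∞))
  have h1 : HasDerivAt (fun t => fderiv ℝ (Function.uncurry g) (t, p) (0, Pi.single α 1))
      (fderiv ℝ (fderiv ℝ (Function.uncurry g)) (s, p) (1, 0) (0, Pi.single α 1)) s := by
    have a := ((hG' (s, p)).hasFDerivAt.comp s (hasFDerivAt_prodMk_left s p)).hasDerivAt
    have := a.clm_apply (hasDerivAt_const s ((0, Pi.single α 1) : ℝ × Plane))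
    simpa using this
  have h2 : pd α (fun p => deriv (fun t => g t p) s) p =
      fderiv ℝ (fderiv ℝ (Function.uncurry g)) (s, p) (0, Pi.single α 1) (1, 0) := by
    simp only [pd, e2]
    have a := (hG' (s, p)).hasFDerivAt.comp p (hasFDerivAt_prodMk_right s p)
    have := a.clm_apply (hasFDerivAt_const ((1, 0) : ℝ × Plane) p)
    have e := this.fderiv
    simp only [Function.comp_apply] at e
    rw [e]
    simp
  rw [h2, hsymm]
  refine h1.congr_of_eventuallyEq (Eventually.of_forall fun t => ?_)
  simp [pd, e1]

/-! ### Euler operators of local densities -/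

section Euler

variable {n k : ℕ}

lemma IsVariation.coord {η : Profile n} (hη : IsVariation η) (i : Fin n) :
    TorusFun (fun p => η p i) := isVariation_iff.1 hη i

lemma jet_add_smul {q η : Profile n} (hq : IsVariation q) (hη : IsVariation η) (s : ℝ)
    (p : Plane) : jet k (q + s • η) p = jet k q p + s • jet k η p := by
  funext i a c
  simp only [jet, Pi.add_apply, Pi.smul_apply, smul_eq_mul]
  rw [pd_iterate_add_const_mul (hq.coord i).1 (hη.coord i).1,
    pd_iterate_add_const_mul (contDiff_pd_iterate (hq.coord i).1 _ _)
      (contDiff_pd_iterate (hη.coord i).1 _ _)]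

lemma jet_coord_torusFun {q : Profile n} (hq : IsVariation q) (i : Fin n) (a c : Fin (k + 1)) :
    TorusFun (fun p => jet k q p i a c) :=
  ((hq.coord i).pd_iterate 1 c).pd_iterate 0 a

lemma contDiff_jet {q : Profile n} (hq : IsVariation q) : ContDiff ℝ ∞ (jet k q) :=
  contDiff_pi.2 fun i => contDiff_pi.2 fun a => contDiff_pi.2 fun c =>
    (jet_coord_torusFun hq i a c).1

lemma periodic_jet {q : Profile n} (hq : IsVariation q) : Periodic (jet k q) := fun α p => by
  funext i a c
  exact (jet_coord_torusFun hq i a c).2 α p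

/-- The unit vector along the jet coordinate `J i a c`. -/
def jetUnit (i : Fin n) (a c : Fin (k + 1)) : Jet n k := Pi.single i (Pi.single a (Pi.single c 1))

lemma jet_eq_sum (J : Jet n k) : J = ∑ i, ∑ a, ∑ c, J i a c • jetUnit i a c := by
  funext i a c
  simp only [Finset.sum_apply, Pi.smul_apply, jetUnit]
  rw [Finset.sum_eq_single i, Finset.sum_eq_single a, Finset.sum_eq_single c]
  · simp
  · intro c' _ h; simp [Pi.single_eq_of_ne h.symm]
  · simp
  · intro a' _ h; simp [Pi.single_eq_of_ne h.symm]
  · simp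
  · intro i' _ h; simp [Pi.single_eq_of_ne h.symm]
  · simp

/-- The derivative of the density `L` along the jet coordinate `J i a c`, evaluated along `q`. -/
def densityPartial (L : Plane × Jet n k → ℝ) (q : Profile n) (i : Fin n) (a c : Fin (k + 1)) :
    Plane → ℝ :=
  fun p => fderiv ℝ L (p, jet k q p) (0, jetUnit i a c)

/-- The Euler operator `E_i(q) = ∑ (-1)^{a+c} ∂_y^c ∂_x^a (∂L/∂J i a c)`. -/
def euler (L : Plane × Jet n k → ℝ) (q : Profile n) : Profile n := fun p i =>
  ∑ a : Fin (k + 1), ∑ c : Fin (k + 1), (-1 : ℝ) ^ ((a : ℕ) + (c : ℕ)) *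
    (pd 1)^[(c : ℕ)] ((pd 0)^[(a : ℕ)] (densityPartial L q i a c)) p

/-- The derivative `η ↦ d/ds E(q + s η)` at `s = 0` of an operator on profiles. -/
def linearization (E : Profile n → Profile n) (q η : Profile n) : Profile n := fun p i =>
  deriv (fun s : ℝ => E (q + s • η) p i) 0

/-- Operators that behave like the variational derivative of a functional: they depend smoothly
on the field, and their linearization is formally self-adjoint. -/
structure IsGradient (E : Profile n → Profile n) : Prop where
  isVariation : ∀ {q}, IsVariation q → IsVariation (E q)
  contDiff : ∀ {q η}, IsVariation q → IsVariation η → ∀ i,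
    ContDiff ℝ ∞ (Function.uncurry fun (s : ℝ) p => E (q + s • η) p i)
  symm : ∀ {q η ζ}, IsVariation q → IsVariation η → IsVariation ζ →
    ∫ p in cell, ∑ i, linearization E q η p i * ζ p i
      = ∫ p in cell, ∑ i, linearization E q ζ p i * η p i

lemma IsGradient.linearization {E : Profile n → Profile n} (hE : IsGradient E) {q η : Profile n}
    (hq : IsVariation q) (hη : IsVariation η) : IsVariation (linearization E q η) :=
  isVariation_iff.2 fun i => TorusFun.deriv_param (hE.contDiff hq hη i)
    (fun t => ((hE.isVariation (hq.add_smul hη t)).coord i).2) 0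

variable {L : Plane × Jet n k → ℝ}

lemma contDiff_jet_param {q η : Profile n} (hq : IsVariation q) (hη : IsVariation η) :
    ContDiff ℝ ∞ (fun z : ℝ × Plane => (z.2, jet k (q + z.1 • η) z.2)) := by
  simp only [jet_add_smul hq hη]
  exact contDiff_snd.prodMk (((contDiff_jet hq).comp contDiff_snd).add
    (contDiff_fst.smul ((contDiff_jet hη).comp contDiff_snd)))

lemma contDiff_densityPartial_param (hL : ContDiff ℝ ∞ L) {q η : Profile n} (hq : IsVariation q)
    (hη : IsVariation η) (i : Fin n) (a c : Fin (k + 1)) :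
    ContDiff ℝ ∞ (Function.uncurry fun (s : ℝ) => densityPartial L (q + s • η) i a c) :=
  ((hL.fderiv_right (m := ∞) (by simp)).comp (contDiff_jet_param hq hη)).clm_apply contDiff_const

lemma fderiv_periodic (hp : ∀ α p J, L (p + Pi.single α 1, J) = L (p, J))
    (α : Fin 2) (p : Plane) (J : Jet n k) :
    fderiv ℝ L (p + Pi.single α 1, J) = fderiv ℝ L (p, J) := by
  have h := fderiv_comp_add_right (𝕜 := ℝ) (f := L) (x := (p, J))
    ((Pi.single α 1, 0) : Plane × Jet n k)
  rw [Prod.mk_add_mk, add_zero] at h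
  rw [← h]
  congr 1
  funext z
  obtain ⟨p, J⟩ := z
  rw [Prod.mk_add_mk, add_zero, hp]

lemma torusFun_densityPartial (hL : ContDiff ℝ ∞ L)
    (hp : ∀ α p J, L (p + Pi.single α 1, J) = L (p, J)) {q : Profile n} (hq : IsVariation q)
    (i : Fin n) (a c : Fin (k + 1)) : TorusFun (densityPartial L q i a c) := by
  refine ⟨((hL.fderiv_right (m := ∞) (by simp)).comp
    (contDiff_id.prodMk (contDiff_jet hq))).clm_apply contDiff_const, fun α p => ?_⟩
  simp only [densityPartial, periodic_jet hq α p, fderiv_periodic hp]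

/-- Integration by parts: the Euler operator represents the first variation of `∫ L`. -/
lemma integral_euler_mul (hL : ContDiff ℝ ∞ L)
    (hp : ∀ α p J, L (p + Pi.single α 1, J) = L (p, J)) {q η : Profile n} (hq : IsVariation q)
    (hη : IsVariation η) :
    ∫ p in cell, ∑ i, euler L q p i * η p i
      = ∫ p in cell, fderiv ℝ L (p, jet k q p) (0, jet k η p) := by
  have e : ∀ p, fderiv ℝ L (p, jet k q p) (0, jet k η p)
      = ∑ i, ∑ a, ∑ c, densityPartial L q i a c p * jet k η p i a c := by
    intro p
    have : ((0, jet k η p) : Plane × Jet n k)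
        = ∑ i, ∑ a, ∑ c, jet k η p i a c • ((0, jetUnit i a c) : Plane × Jet n k) := by
      ext1
      · simp [Prod.fst_sum]
      · simp only [Prod.snd_sum, Prod.smul_snd]
        exact jet_eq_sum _
    rw [this]
    simp only [map_sum, map_smul, smul_eq_mul, densityPartial]
    simp only [mul_comm]
  simp only [e, euler, Finset.sum_mul]
  have hT := fun i a c => torusFun_densityPartial hL hp hq i a c
  have hE : ∀ i (a c : Fin (k + 1)), TorusFun (fun p => (-1 : ℝ) ^ ((a : ℕ) + (c : ℕ)) *
      (pd 1)^[(c : ℕ)] ((pd 0)^[(a : ℕ)] (densityPartial L q i a c)) p * η p i) := fun i a c =>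
    ((TorusFun.const _).mul (((hT i a c).pd_iterate 0 a).pd_iterate 1 c)).mul (hη.coord i)
  have hJ : ∀ i a c, TorusFun (fun p => densityPartial L q i a c p * jet k η p i a c) :=
    fun i a c => (hT i a c).mul (jet_coord_torusFun hη i a c)
  rw [integral_finsetSum _ fun i _ => (TorusFun.sum fun a _ => TorusFun.sum fun c _ =>
      hE i a c).integrableOn,
    integral_finsetSum _ fun i _ => (TorusFun.sum fun a _ => TorusFun.sum fun c _ =>
      hJ i a c).integrableOn]
  refine Finset.sum_congr rfl fun i _ => ?_
  rw [integral_finsetSum _ fun a _ => (TorusFun.sum fun c _ => hE i a c).integrableOn,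
    integral_finsetSum _ fun a _ => (TorusFun.sum fun c _ => hJ i a c).integrableOn]
  refine Finset.sum_congr rfl fun a _ => ?_
  rw [integral_finsetSum _ fun c _ => (hE i a c).integrableOn,
    integral_finsetSum _ fun c _ => (hJ i a c).integrableOn]
  refine Finset.sum_congr rfl fun c _ => ?_
  simp only [jet]
  rw [integral_mul_pd_iterate (hT i a c) ((hη.coord i).pd_iterate 1 c) 0 a,
    integral_mul_pd_iterate ((hT i a c).pd_iterate 0 a) (hη.coord i) 1 c, ← mul_assoc, ← pow_add,
    ← integral_const_mul]
  simp only [mul_assoc]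

lemma contDiff_euler_param (hL : ContDiff ℝ ∞ L) {q η : Profile n} (hq : IsVariation q)
    (hη : IsVariation η) (i : Fin n) :
    ContDiff ℝ ∞ (Function.uncurry fun (s : ℝ) p => euler L (q + s • η) p i) := by
  change ContDiff ℝ ∞ (fun z : ℝ × Plane => ∑ a : Fin (k + 1), ∑ c : Fin (k + 1),
    (-1 : ℝ) ^ ((a : ℕ) + (c : ℕ)) * (Function.uncurry fun (s : ℝ) =>
      (pd 1)^[(c : ℕ)] ((pd 0)^[(a : ℕ)] (densityPartial L (q + s • η) i a c))) z)
  exact ContDiff.sum fun a _ => ContDiff.sum fun c _ => contDiff_const.mul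
    (contDiff_pd_iterate_param (contDiff_pd_iterate_param
      (contDiff_densityPartial_param hL hq hη i a c) 0 a) 1 c)

lemma isVariation_euler (hL : ContDiff ℝ ∞ L)
    (hp : ∀ α p J, L (p + Pi.single α 1, J) = L (p, J)) {q : Profile n} (hq : IsVariation q) :
    IsVariation (euler L q) :=
  isVariation_iff.2 fun i => TorusFun.sum fun a _ => TorusFun.sum fun c _ =>
    (TorusFun.const _).mul (((torusFun_densityPartial hL hp hq i a c).pd_iterate 0 a).pd_iterate 1 c)

/-- Pairing with a fixed variation commutes with differentiation along a line of profiles. -/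
lemma hasDerivAt_integral_pairing {E : Profile n → Profile n} {q η ζ : Profile n}
    (hE : ∀ i, ContDiff ℝ ∞ (Function.uncurry fun (s : ℝ) p => E (q + s • η) p i))
    (hζ : IsVariation ζ) :
    HasDerivAt (fun s : ℝ => ∫ p in cell, ∑ i, E (q + s • η) p i * ζ p i)
      (∫ p in cell, ∑ i, linearization E q η p i * ζ p i) 0 := by
  have h := hasDerivAt_integral_cell (g := fun s p => ∑ i, E (q + s • η) p i * ζ p i)
    (ContDiff.sum fun i _ => (hE i).mul ((hζ.coord i).1.comp contDiff_snd)) 0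
  convert h using 4 with p
  have hd : ∀ i, HasDerivAt (fun s : ℝ => E (q + s • η) p i) (linearization E q η p i) 0 := fun i =>
    (((hE i).comp (contDiff_id.prodMk (contDiff_const (c := p)))).differentiable
      (by simp) 0).hasDerivAt
  exact (HasDerivAt.fun_sum fun i _ => (hd i).mul_const (ζ p i)).deriv.symm

lemma hasDerivAt_comp_jet {F : Type*} [NormedAddCommGroup F] [NormedSpace ℝ F]
    {G : Plane × Jet n k → F} (hG : ContDiff ℝ ∞ G) {q η : Profile n} (hq : IsVariation q)
    (hη : IsVariation η) (p : Plane) :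
    HasDerivAt (fun s : ℝ => G (p, jet k (q + s • η) p))
      (fderiv ℝ G (p, jet k q p) (0, jet k η p)) 0 := by
  simp only [jet_add_smul hq hη]
  have hc : HasDerivAt (fun s : ℝ => (p, jet k q p + s • jet k η p)) (0, jet k η p) 0 := by
    refine (hasDerivAt_const _ _).prodMk ?_
    simpa using ((hasDerivAt_id (0 : ℝ)).smul_const (jet k η p)).const_add (jet k q p)
  have hd := (hG.differentiable (by simp) (p, jet k q p + (0 : ℝ) • jet k η p)).hasFDerivAt
  have h := hd.comp_hasDerivAt (0 : ℝ) hc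
  rw [zero_smul, add_zero] at h
  exact h

/-- The derivative of the first variation of `∫ L` is the second derivative of `L`. -/
lemma integral_linearization_euler (hL : ContDiff ℝ ∞ L)
    (hp : ∀ α p J, L (p + Pi.single α 1, J) = L (p, J)) {q η ζ : Profile n} (hq : IsVariation q)
    (hη : IsVariation η) (hζ : IsVariation ζ) :
    ∫ p in cell, ∑ i, linearization (euler L) q η p i * ζ p i
      = ∫ p in cell, fderiv ℝ (fderiv ℝ L) (p, jet k q p) (0, jet k η p) (0, jet k ζ p) := by
  have h1 := hasDerivAt_integral_pairing (contDiff_euler_param hL hq hη) hζ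
  simp only [fun s : ℝ => integral_euler_mul hL hp (hq.add_smul hη s) hζ] at h1
  have hL' : ContDiff ℝ ∞ (fderiv ℝ L) := hL.fderiv_right (by simp)
  have h2 := hasDerivAt_integral_cell
    (g := fun (s : ℝ) p => fderiv ℝ L (p, jet k (q + s • η) p) (0, jet k ζ p))
    ((hL'.comp (contDiff_jet_param hq hη)).clm_apply
      (contDiff_const.prodMk ((contDiff_jet hζ).comp contDiff_snd))) 0
  rw [h1.unique h2]
  congr 1
  funext p
  refine HasDerivAt.deriv ?_
  have := (hasDerivAt_comp_jet hL' hq hη p).clm_apply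
    (hasDerivAt_const (0 : ℝ) ((0, jet k ζ p) : Plane × Jet n k))
  rwa [map_zero, add_zero] at this

lemma isGradient_euler (hL : ContDiff ℝ ∞ L)
    (hp : ∀ α p J, L (p + Pi.single α 1, J) = L (p, J)) : IsGradient (euler L) where
  isVariation := isVariation_euler hL hp
  contDiff := contDiff_euler_param hL
  symm := fun {q η ζ} hq hη hζ => by
    rw [integral_linearization_euler hL hp hq hη hζ, integral_linearization_euler hL hp hq hζ hη]
    congr 1
    funext p
    have hsymm : IsSymmSndFDerivAt ℝ L (p, jet k q p) := hL.contDiffAt.isSymmSndFDerivAt (by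
      simpa using (WithTop.coe_le_coe.2 le_top : ((2 : ℕ∞) : WithTop ℕ∞) ≤ ∞))
    exact hsymm _ _

lemma hasDerivAt_integral_density (hL : ContDiff ℝ ∞ L)
    (hp : ∀ α p J, L (p + Pi.single α 1, J) = L (p, J)) {q η : Profile n} (hq : IsVariation q)
    (hη : IsVariation η) :
    HasDerivAt (fun s : ℝ => ∫ p in cell, L (p, jet k (q + s • η) p))
      (∫ p in cell, ∑ i, euler L q p i * η p i) 0 := by
  rw [integral_euler_mul hL hp hq hη]
  have h2 := hasDerivAt_integral_cell (g := fun (s : ℝ) p => L (p, jet k (q + s • η) p))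
    (hL.comp (contDiff_jet_param hq hη)) 0
  convert h2 using 3 with p
  exact (hasDerivAt_comp_jet hL hq hη p).deriv.symm

end Euler

/-! ### Variational derivatives of local functionals -/

section VarDeriv

variable {n : ℕ}

lemma HasVarDeriv.unique {K : Functional n} {q φ ψ : Profile n} (hφ : HasVarDeriv K q φ)
    (hψ : HasVarDeriv K q ψ) : φ = ψ := by
  have hc := fun i => (hφ.1.coord i)
  have hc' := fun i => (hψ.1.coord i)
  have hd : ∀ i, TorusFun (fun p => φ p i - ψ p i) := fun i => (hc i).sub (hc' i)
  have hη : IsVariation (fun p i => φ p i - ψ p i) := isVariation_iff.2 hd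
  have h := (hφ.2 _ hη).unique (hψ.2 _ hη)
  rw [← sub_eq_zero, ← integral_sub
    (TorusFun.sum fun i _ => (hc i).mul (hd i)).integrableOn
    (TorusFun.sum fun i _ => (hc' i).mul (hd i)).integrableOn] at h
  have hz := (TorusFun.sum fun i (_ : i ∈ Finset.univ) => (hd i).mul (hd i)).eq_zero_of_integral
    (fun p => Finset.sum_nonneg fun i _ => mul_self_nonneg _) (by
      rw [← h]
      congr 1
      funext p
      rw [← Finset.sum_sub_distrib]
      exact Finset.sum_congr rfl fun i _ => by ring)
  funext p i
  have h1 := (Finset.sum_eq_zero_iff_of_nonneg fun i _ => mul_self_nonneg _).1 (hz p) i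
    (Finset.mem_univ i)
  exact sub_eq_zero.1 (mul_self_eq_zero.1 h1)

lemma HasVarDeriv.varDeriv_eq {K : Functional n} {q φ : Profile n} (h : HasVarDeriv K q φ) :
    varDeriv K q = φ := by
  have hex : ∃ φ, HasVarDeriv K q φ := ⟨φ, h⟩
  rw [varDeriv, dif_pos hex]
  exact hex.choose_spec.unique h

/-- Small variations of a field with values in an open set keep their values there. -/
lemma IsField.eventually_add_smul {W : Set (State n)} (hW : IsOpen W) {q η : Profile n}
    (hq : IsField W q) (hη : IsVariation η) : ∀ᶠ s : ℝ in 𝓝 0, IsField W (q + s • η) := by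
  have hc : Continuous (fun z : ℝ × Plane => (q + z.1 • η) z.2) :=
    (hq.1.continuous.comp continuous_snd).add
      (continuous_fst.smul (hη.1.continuous.comp continuous_snd))
  have h : ∀ᶠ s : ℝ in 𝓝 0, ∀ p ∈ cell, (q + s • η) p ∈ W := by
    refine (isCompact_Icc : IsCompact cell).eventually_forall_of_forall_eventually fun p _ => ?_
    refine hc.continuousAt.eventually (hW.mem_nhds ?_)
    simpa using hq.2.2 p
  filter_upwards [h] with s hs
  have hv := IsVariation.add_smul ⟨hq.1, hq.2.1⟩ hη s
  refine ⟨hv.1, hv.2, fun p => ?_⟩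
  obtain ⟨p', hp', e⟩ := hv.2.exists_mem_cell p
  rw [← e]
  exact hs p' hp'

lemma contDiff_cutoff_mul {E : Type*} [NormedAddCommGroup E] [NormedSpace ℝ E] {V : Set E}
    (hV : IsOpen V) {χ f : E → ℝ} (hχ : ContDiff ℝ ∞ χ) (hs : tsupport χ ⊆ V)
    (hf : ContDiffOn ℝ ∞ f V) : ContDiff ℝ ∞ (fun x => χ x * f x) := by
  refine contDiff_iff_contDiffAt.2 fun x => ?_
  by_cases hx : x ∈ tsupport χ
  · exact hχ.contDiffAt.mul (hf.contDiffAt (hV.mem_nhds (hs hx)))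
  · refine (contDiffAt_const (c := (0 : ℝ))).congr_of_eventuallyEq ?_
    filter_upwards [(isClosed_tsupport χ).isOpen_compl.mem_nhds hx] with y hy
    rw [image_eq_zero_of_notMem_tsupport hy, zero_mul]

/-- A smooth cutoff of `U` which is equal to `1` on a neighbourhood `W` of the values of a
field. -/
lemma IsField.exists_cutoff {U : Set (State n)} (hU : IsOpen U) {q : Profile n}
    (hq : IsField U q) : ∃ (χ : State n → ℝ) (W : Set (State n)), ContDiff ℝ ∞ χ ∧
      tsupport χ ⊆ U ∧ IsOpen W ∧ IsField W q ∧ ∀ s ∈ W, χ s = 1 := by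
  have hr : range q = q '' cell := by
    ext s
    constructor
    · rintro ⟨p, rfl⟩
      obtain ⟨p', hp', e⟩ := hq.2.1.exists_mem_cell p
      exact ⟨p', hp', e⟩
    · rintro ⟨p, _, rfl⟩
      exact mem_range_self p
  have hK : IsCompact (range q) := hr ▸ (isCompact_Icc : IsCompact cell).image hq.1.continuous
  obtain ⟨t, ht, hKt, htU⟩ := exists_compact_between hK hU (range_subset_iff.2 hq.2.2)
  obtain ⟨χ, h1, h0, -⟩ := exists_contMDiffMap_one_nhds_of_subset_interior
    (n := (⊤ : ℕ∞)) (modelWithCornersSelf ℝ (State n)) hK.isClosed hKt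
  obtain ⟨W, hW, hKW, hW1⟩ := mem_nhdsSet_iff_exists.1 h1
  refine ⟨χ, W, χ.contMDiff.contDiff, ?_, hW, ⟨hq.1, hq.2.1, fun p => hKW (mem_range_self p)⟩,
    fun s hs => hW1 hs⟩
  refine (closure_minimal (fun x hx => ?_) ht.isClosed).trans htU
  by_contra hxt
  exact hx (h0 x hxt)

lemma subset_of_cutoff {U W : Set (State n)} {χ : State n → ℝ} (hs : tsupport χ ⊆ U)
    (h1 : ∀ s ∈ W, χ s = 1) : W ⊆ U := fun s hsW =>
  hs (subset_tsupport χ (by simp [h1 s hsW]))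

lemma IsField.mono {U W : Set (State n)} (h : W ⊆ U) {q : Profile n} (hq : IsField W q) :
    IsField U q := ⟨hq.1, hq.2.1, fun p => h (hq.2.2 p)⟩

lemma IsField.isVariation {U : Set (State n)} {q : Profile n} (hq : IsField U q) :
    IsVariation q := ⟨hq.1, hq.2.1⟩

/-- Near a field, the density of a local functional can be replaced by one that is smooth
everywhere, so that its variational derivative is given by an Euler operator. -/
lemma IsLocal.exists_gradient {U W : Set (State n)} (hU : IsOpen U) (hW : IsOpen W)
    {χ : State n → ℝ} (hχ : ContDiff ℝ ∞ χ) (hs : tsupport χ ⊆ U) (h1 : ∀ s ∈ W, χ s = 1)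
    {F : Functional n} (hF : IsLocal U F) :
    ∃ E : Profile n → Profile n, IsGradient E ∧
      ∀ q, IsField W q → HasVarDeriv F q (E q) := by
  obtain ⟨k, L, hL, hp, hFL⟩ := hF
  have hπ : ContDiff ℝ ∞ (fun z : Plane × Jet n k => (fun i => z.2 i 0 0 : State n)) := by
    fun_prop
  set M : Plane × Jet n k → ℝ := fun z => χ (fun i => z.2 i 0 0) * L z with hM
  have hMs : ContDiff ℝ ∞ M := by
    refine contDiff_cutoff_mul (hU.preimage hπ.continuous) (hχ.comp hπ) ?_ hL
    exact (tsupport_comp_subset_preimage χ hπ.continuous).trans (preimage_mono hs)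
  have hMp : ∀ α p J, M (p + Pi.single α 1, J) = M (p, J) := fun α p J => by simp only [hM, hp]
  refine ⟨euler M, isGradient_euler hMs hMp, fun q hq =>
    ⟨isVariation_euler hMs hMp hq.isVariation, fun η hη => ?_⟩⟩
  refine (hasDerivAt_integral_density hMs hMp hq.isVariation hη).congr_of_eventuallyEq ?_
  filter_upwards [hq.eventually_add_smul hW hη] with s hsW
  rw [hFL _ (hsW.mono (subset_of_cutoff hs h1))]
  congr 1
  funext p
  have : χ (fun i => jet k (q + s • η) p i 0 0) = 1 := h1 _ (hsW.2.2 p)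
  simp only [hM, this, one_mul]

end VarDeriv

/-! ### The operators `hydroOp m f` -/

/-- The operator `[[D + v_y / 2, h], [-h, 0]]` with `D = d/dx + v d/dy` and
`h = f + m (v_x + v v_y)`, where `m` and `f` are functions of `(u, v)`. -/
def hydroOp (m f : State 2 → ℝ) : Operator 2 where
  g := P₁.g
  b := fun α k i j s =>
    (![![0, !![0, m s; -m s, 0]],
       ![0, !![1 / 2, m s * s 1; -(m s * s 1), 0]]] :
      Fin 2 → Fin 2 → Matrix (Fin 2) (Fin 2) ℝ) α k i j
  w := ultralocal f

lemma P₁_addUltralocal (f : State 2 → ℝ) :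
    P₁.addUltralocal (ultralocal f) = hydroOp (fun _ => 0) f := by
  simp only [Operator.addUltralocal, hydroOp, P₁, Operator.mk.injEq, true_and]
  constructor
  · funext α k i j s
    fin_cases α <;> fin_cases k <;> fin_cases i <;> fin_cases j <;> simp
  · funext i j s
    simp

lemma P₂_addUltralocal (f : State 2 → ℝ) :
    P₂.addUltralocal (ultralocal f) = hydroOp (fun s => -(1 / s 0)) f := by
  simp only [Operator.addUltralocal, hydroOp, P₁, P₂, Operator.mk.injEq, true_and]
  constructor
  · funext α k i j s
    fin_cases α <;> fin_cases k <;> fin_cases i <;> fin_cases j <;>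
      simp [div_eq_mul_inv, mul_comm]
  · funext i j s
    simp

/-- The derivation `D = d/dx + v d/dy`. -/
def transport (q : Profile 2) (h : Plane → ℝ) : Plane → ℝ :=
  fun p => pd 0 h p + q p 1 * pd 1 h p

/-- The off-diagonal entry `h = f + m (v_x + v v_y)` of the operator. -/
def offDiag (m f : State 2 → ℝ) (q : Profile 2) : Plane → ℝ :=
  fun p => f (q p) + m (q p) * transport q (fun p => q p 1) p

/-- The determinant `φ₀ ψ₁ - φ₁ ψ₀`. -/
def wedge (φ ψ : Profile 2) : Plane → ℝ := fun p => φ p 0 * ψ p 1 - φ p 1 * ψ p 0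

lemma hydroOp_app_zero (m f : State 2 → ℝ) (q ψ : Profile 2) (p : Plane) :
    (hydroOp m f).app q ψ p 0 = transport q (fun p => ψ p 0) p
      + 1 / 2 * pd 1 (fun p => q p 1) p * ψ p 0 + offDiag m f q p * ψ p 1 := by
  simp [Operator.app, hydroOp, P₁, ultralocal, transport, offDiag, Fin.sum_univ_two]
  ring

lemma hydroOp_app_one (m f : State 2 → ℝ) (q ψ : Profile 2) (p : Plane) :
    (hydroOp m f).app q ψ p 1 = -(offDiag m f q p * ψ p 0) := by
  simp [Operator.app, hydroOp, P₁, ultralocal, transport, offDiag, Fin.sum_univ_two]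
  ring

/-- The operator only depends on the values of `m` and `f` along the field. -/
lemma hydroOp_app_congr {m f m' f' : State 2 → ℝ} {q : Profile 2} (hm : ∀ p, m (q p) = m' (q p))
    (hf : ∀ p, f (q p) = f' (q p)) (ψ : Profile 2) :
    (hydroOp m f).app q ψ = (hydroOp m' f').app q ψ := by
  funext p i
  fin_cases i
  · simp only [Fin.zero_eta, hydroOp_app_zero, offDiag, hm, hf]
  · simp only [Fin.mk_one, hydroOp_app_one, offDiag, hm, hf]

/-- The `L²` pairing of profiles over the period cell. -/
def pairing {n : ℕ} (φ ψ : Profile n) : ℝ := ∫ p in cell, ∑ i, φ p i * ψ p i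

lemma torusFun_sum_mul {n : ℕ} {φ ψ : Profile n} (hφ : IsVariation φ) (hψ : IsVariation ψ) :
    TorusFun (fun p => ∑ i, φ p i * ψ p i) :=
  TorusFun.sum fun i _ => (hφ.coord i).mul (hψ.coord i)

lemma bracket_eq_pairing {n : ℕ} (P : Operator n) (K H : Functional n) (q : Profile n) :
    bracket P K H q = pairing (varDeriv K q) (P.app q (varDeriv H q)) := rfl

/-- Functions that differ by a divergence have the same integral. -/
lemma integral_eq_of_sub_eq_pd {g h a b : Plane → ℝ} (hh : TorusFun h)
    (ha : TorusFun a) (hb : TorusFun b) (e : ∀ p, g p = h p + (pd 0 a p + pd 1 b p)) :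
    ∫ p in cell, g p = ∫ p in cell, h p := by
  simp only [e]
  rw [integral_add hh.integrableOn ((ha.pd 0).add (hb.pd 1)).integrableOn,
    integral_add (ha.pd 0).integrableOn (hb.pd 1).integrableOn, integral_pd ha, integral_pd hb]
  simp

/-! ### Smoothness and skew-symmetry -/

section Smooth

variable {m f : State 2 → ℝ} {q φ ψ χ η : Profile 2}

lemma torusFun_transport (hq : IsVariation q) {h : Plane → ℝ} (hh : TorusFun h) :
    TorusFun (transport q h) := (hh.pd 0).add ((hq.coord 1).mul (hh.pd 1))

lemma torusFun_offDiag (hm : ContDiff ℝ ∞ m) (hf : ContDiff ℝ ∞ f) (hq : IsVariation q) :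
    TorusFun (offDiag m f q) :=
  (hq.comp hf).add ((hq.comp hm).mul (torusFun_transport hq (hq.coord 1)))

lemma torusFun_wedge (hφ : IsVariation φ) (hψ : IsVariation ψ) : TorusFun (wedge φ ψ) :=
  ((hφ.coord 0).mul (hψ.coord 1)).sub ((hφ.coord 1).mul (hψ.coord 0))

lemma isVariation_app (hm : ContDiff ℝ ∞ m) (hf : ContDiff ℝ ∞ f) (hq : IsVariation q)
    (hψ : IsVariation ψ) : IsVariation ((hydroOp m f).app q ψ) := by
  refine isVariation_iff.2 fun i => ?_
  have ho := torusFun_offDiag hm hf hq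
  fin_cases i
  · simp only [Fin.zero_eta, hydroOp_app_zero]
    exact ((torusFun_transport hq (hψ.coord 0)).add
      (((TorusFun.const _).mul ((hq.coord 1).pd 1)).mul (hψ.coord 0))).add (ho.mul (hψ.coord 1))
  · simp only [Fin.mk_one, hydroOp_app_one]
    exact (ho.mul (hψ.coord 0)).neg

lemma pairing_app_skew (hm : ContDiff ℝ ∞ m) (hf : ContDiff ℝ ∞ f) (hq : IsVariation q)
    (hφ : IsVariation φ) (hψ : IsVariation ψ) :
    pairing φ ((hydroOp m f).app q ψ) = -pairing ψ ((hydroOp m f).app q φ) := by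
  have h1 := torusFun_sum_mul hφ (isVariation_app hm hf hq hψ)
  have h2 := torusFun_sum_mul hψ (isVariation_app hm hf hq hφ)
  have h0 := (hφ.coord 0).mul (hψ.coord 0)
  rw [pairing, pairing, ← integral_neg]
  refine integral_eq_of_sub_eq_pd h2.neg h0 ((hq.coord 1).mul h0) fun p => ?_
  rw [pd_mul (hq.coord 1).1 h0.1, pd_mul (hφ.coord 0).1 (hψ.coord 0).1,
    pd_mul (hφ.coord 0).1 (hψ.coord 0).1]
  simp only [Fin.sum_univ_two, hydroOp_app_zero, hydroOp_app_one, transport]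
  ring

/-! ### The variation of the bracket -/

/-- The derivative of `offDiag m f` along `η`. -/
def offDiagVar (m f : State 2 → ℝ) (q η : Profile 2) : Plane → ℝ := fun p =>
  fderiv ℝ f (q p) (η p) + fderiv ℝ m (q p) (η p) * transport q (fun p => q p 1) p
    + m (q p) * (transport q (fun p => η p 1) p + η p 1 * pd 1 (fun p => q p 1) p)

/-- The density `φ · P'_η ψ`, where `P'_η` is the derivative along `η` of the coefficients of the
operator `hydroOp m f`. -/
def coeffVar (m f : State 2 → ℝ) (q φ ψ η : Profile 2) : Plane → ℝ := fun p =>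
  η p 1 * φ p 0 * pd 1 (fun p => ψ p 0) p + 1 / 2 * pd 1 (fun p => η p 1) p * φ p 0 * ψ p 0
    + offDiagVar m f q η p * wedge φ ψ p

lemma IsVariation.fderiv_apply {f : State 2 → ℝ} (hf : ContDiff ℝ ∞ f) (hq : IsVariation q)
    (hη : IsVariation η) : TorusFun (fun p => fderiv ℝ f (q p) (η p)) :=
  ⟨((hf.fderiv_right (m := ∞) (by simp)).comp hq.1).clm_apply hη.1, fun α p => by
    simp only [hq.2 α p, hη.2 α p]⟩

lemma torusFun_offDiagVar (hm : ContDiff ℝ ∞ m) (hf : ContDiff ℝ ∞ f) (hq : IsVariation q)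
    (hη : IsVariation η) : TorusFun (offDiagVar m f q η) :=
  ((hq.fderiv_apply hf hη).add ((hq.fderiv_apply hm hη).mul
    (torusFun_transport hq (hq.coord 1)))).add ((hq.comp hm).mul
      ((torusFun_transport hq (hη.coord 1)).add ((hη.coord 1).mul ((hq.coord 1).pd 1))))

lemma torusFun_coeffVar (hm : ContDiff ℝ ∞ m) (hf : ContDiff ℝ ∞ f) (hq : IsVariation q)
    (hφ : IsVariation φ) (hψ : IsVariation ψ) (hη : IsVariation η) :
    TorusFun (coeffVar m f q φ ψ η) :=
  ((((hη.coord 1).mul (hφ.coord 0)).mul ((hψ.coord 0).pd 1)).add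
    ((((TorusFun.const _).mul ((hη.coord 1).pd 1)).mul (hφ.coord 0)).mul (hψ.coord 0))).add
    ((torusFun_offDiagVar hm hf hq hη).mul (torusFun_wedge hφ hψ))

/-- The derivative of the bracket of two functionals with gradients `E₁` and `E₂` along a line of
profiles. The operator is skew-symmetric, so that the derivative of `E₂` can be moved to the
left. -/
lemma hasDerivAt_pairing_app (hm : ContDiff ℝ ∞ m) (hf : ContDiff ℝ ∞ f)
    {E₁ E₂ : Profile 2 → Profile 2} (h₁ : IsGradient E₁) (h₂ : IsGradient E₂)
    (hq : IsVariation q) (hη : IsVariation η) :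
    HasDerivAt (fun s : ℝ => pairing (E₁ (q + s • η))
        ((hydroOp m f).app (q + s • η) (E₂ (q + s • η))))
      (pairing (linearization E₁ q η) ((hydroOp m f).app q (E₂ q))
        - pairing (linearization E₂ q η) ((hydroOp m f).app q (E₁ q))
        + ∫ p in cell, coeffVar m f q (E₁ q) (E₂ q) η p) 0 := by
  have hQ : ContDiff ℝ ∞ (Function.uncurry fun (s : ℝ) p => (q + s • η) p) :=
    (hq.1.comp contDiff_snd).add (contDiff_fst.smul (hη.1.comp contDiff_snd))
  have hV : ContDiff ℝ ∞ (Function.uncurry fun (s : ℝ) p => (q + s • η) p 1) :=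
    contDiff_pi.1 hQ 1
  have c₁ := fun i => h₁.contDiff hq hη i
  have c₂ := fun i => h₂.contDiff hq hη i
  have hD : ∀ {h : ℝ → Plane → ℝ}, ContDiff ℝ ∞ (Function.uncurry h) →
      ContDiff ℝ ∞ (Function.uncurry fun s => transport (q + s • η) (h s)) := fun hh =>
    (contDiff_pd_param hh 0).add (hV.mul (contDiff_pd_param hh 1))
  have hO : ContDiff ℝ ∞ (Function.uncurry fun (s : ℝ) => offDiag m f (q + s • η)) :=
    (hf.comp hQ).add ((hm.comp hQ).mul (hD hV))
  have hI : ContDiff ℝ ∞ (Function.uncurry fun (s : ℝ) p => ∑ i, E₁ (q + s • η) p i *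
      (hydroOp m f).app (q + s • η) (E₂ (q + s • η)) p i) := by
    simp only [Fin.sum_univ_two, hydroOp_app_zero, hydroOp_app_one]
    exact ((c₁ 0).mul (((hD (c₂ 0)).add ((contDiff_const.mul (contDiff_pd_param hV 1)).mul
      (c₂ 0))).add (hO.mul (c₂ 1)))).add ((c₁ 1).mul (hO.mul (c₂ 0)).neg)
  have hint := hasDerivAt_integral_cell hI 0
  have hl₁ := h₁.linearization hq hη
  have hl₂ := h₂.linearization hq hη
  have hE₁ := h₁.isVariation hq
  have hE₂ := h₂.isVariation hq
  have hval : pairing (linearization E₁ q η) ((hydroOp m f).app q (E₂ q))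
        - pairing (linearization E₂ q η) ((hydroOp m f).app q (E₁ q))
        + ∫ p in cell, coeffVar m f q (E₁ q) (E₂ q) η p
      = ∫ p in cell, ((∑ i, linearization E₁ q η p i * (hydroOp m f).app q (E₂ q) p i)
        + (∑ i, E₁ q p i * (hydroOp m f).app q (linearization E₂ q η) p i)
        + coeffVar m f q (E₁ q) (E₂ q) η p) := by
    have t₁ := torusFun_sum_mul hl₁ (isVariation_app hm hf hq hE₂)
    have t₂ := torusFun_sum_mul hE₁ (isVariation_app hm hf hq hl₂)
    rw [integral_add (t₁.add t₂).integrableOn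
      (torusFun_coeffVar hm hf hq hE₁ hE₂ hη).integrableOn,
      integral_add t₁.integrableOn t₂.integrableOn]
    have := pairing_app_skew hm hf hq hE₁ hl₂
    simp only [pairing] at this ⊢
    linarith
  rw [hval]
  refine hint.congr_deriv ?_
  congr 1
  funext p
  refine HasDerivAt.deriv ?_
  -- the derivatives at `s = 0` of the factors of the density
  have dline : ∀ {h : ℝ → Plane → ℝ}, ContDiff ℝ ∞ (Function.uncurry h) →
      HasDerivAt (fun s => h s p) (deriv (fun s => h s p) 0) 0 := fun hh =>
    ((hh.comp (contDiff_id.prodMk (contDiff_const (c := p)))).differentiable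
      (by simp) 0).hasDerivAt
  have dQ : ∀ p, HasDerivAt (fun s : ℝ => (q + s • η) p) (η p) 0 := fun p => by
    simpa using ((hasDerivAt_id (0 : ℝ)).smul_const (η p)).const_add (q p)
  have dV : ∀ p, HasDerivAt (fun s : ℝ => (q + s • η) p 1) (η p 1) 0 := fun p =>
    hasDerivAt_pi.1 (dQ p) 1
  have dpV : ∀ α, HasDerivAt (fun s : ℝ => pd α (fun p => (q + s • η) p 1) p)
      (pd α (fun p => η p 1) p) 0 := fun α => by
    have := hasDerivAt_pd_param hV α 0 p
    simpa only [fun p => (dV p).deriv] using this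
  have dcomp : ∀ {g : State 2 → ℝ}, ContDiff ℝ ∞ g →
      HasDerivAt (fun s : ℝ => g ((q + s • η) p)) (fderiv ℝ g (q p) (η p)) 0 := fun {g} hg => by
    have h := (hg.differentiable (by simp) ((q + (0 : ℝ) • η) p)).hasFDerivAt
    have := h.comp_hasDerivAt (0 : ℝ) (dQ p)
    rw [zero_smul, add_zero] at this
    exact this
  have d₁ := fun i => dline (c₁ i)
  have d₂ := fun i => dline (c₂ i)
  have dp₂ := fun α => hasDerivAt_pd_param (c₂ 0) α 0 p
  have hO' := (dcomp hf).add ((dcomp hm).mul ((dpV 0).add ((dV p).mul (dpV 1))))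
  have h0 := (d₁ 0).mul ((((dp₂ 0).add ((dV p).mul (dp₂ 1))).add
    (((dpV 1).const_mul (1 / 2)).mul (d₂ 0))).add (hO'.mul (d₂ 1)))
  have h1 := (d₁ 1).mul (hO'.mul (d₂ 0)).neg
  have hsum := h0.add h1
  simp only [Fin.sum_univ_two, hydroOp_app_zero, hydroOp_app_one]
  refine (hsum.congr_deriv ?_).congr_of_eventuallyEq (Eventually.of_forall fun s => ?_)
  · simp only [zero_smul, add_zero, Pi.smul_apply, Pi.zero_apply, coeffVar, offDiagVar, offDiag,
      wedge, transport, linearization, Pi.add_apply, Pi.mul_apply, Pi.neg_apply]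
    ring
  · simp only [offDiag, transport, Pi.add_apply, Pi.mul_apply, Pi.neg_apply]

/-- The profile `T` with `∫ φ · P'_η ψ = ∫ T · η` for all `η`. -/
def coeffGrad (m f : State 2 → ℝ) (q φ ψ : Profile 2) : Profile 2 := fun p =>
  ![(fderiv ℝ f (q p) (Pi.single 0 1)
      + fderiv ℝ m (q p) (Pi.single 0 1) * transport q (fun p => q p 1) p) * wedge φ ψ p,
    φ p 0 * pd 1 (fun p => ψ p 0) p - 1 / 2 * pd 1 (fun p => φ p 0 * ψ p 0) p
      + (fderiv ℝ f (q p) (Pi.single 1 1)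
        + fderiv ℝ m (q p) (Pi.single 1 1) * transport q (fun p => q p 1) p
        + m (q p) * pd 1 (fun p => q p 1) p) * wedge φ ψ p
      - pd 0 (fun p => m (q p) * wedge φ ψ p) p
      - pd 1 (fun p => q p 1 * (m (q p) * wedge φ ψ p)) p]

lemma isVariation_const (s : State 2) : IsVariation (fun _ => s) :=
  ⟨contDiff_const, fun _ _ => rfl⟩

lemma isVariation_coeffGrad (hm : ContDiff ℝ ∞ m) (hf : ContDiff ℝ ∞ f) (hq : IsVariation q)
    (hφ : IsVariation φ) (hψ : IsVariation ψ) : IsVariation (coeffGrad m f q φ ψ) := by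
  have hd := fun {g : State 2 → ℝ} (hg : ContDiff ℝ ∞ g) (s : State 2) =>
    hq.fderiv_apply hg (isVariation_const s)
  have hA := torusFun_transport hq (hq.coord 1)
  have hw := torusFun_wedge hφ hψ
  have hmw := (hq.comp hm).mul hw
  refine isVariation_iff.2 fun i => ?_
  fin_cases i
  · exact ((hd hf _).add ((hd hm _).mul hA)).mul hw
  · exact (((((hφ.coord 0).mul ((hψ.coord 0).pd 1)).sub ((TorusFun.const _).mul
      (((hφ.coord 0).mul (hψ.coord 0)).pd 1))).add ((((hd hf _).add ((hd hm _).mul hA)).add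
        ((hq.comp hm).mul ((hq.coord 1).pd 1))).mul hw)).sub (hmw.pd 0)).sub
          (((hq.coord 1).mul hmw).pd 1)

lemma fderiv_state_apply (g : State 2 → ℝ) (s t : State 2) :
    fderiv ℝ g s t = t 0 * fderiv ℝ g s (Pi.single 0 1) + t 1 * fderiv ℝ g s (Pi.single 1 1) := by
  have : t = t 0 • (Pi.single 0 1 : State 2) + t 1 • (Pi.single 1 1 : State 2) := by
    funext i; fin_cases i <;> simp
  conv_lhs => rw [this]
  simp only [map_add, map_smul, smul_eq_mul]

lemma integral_coeffVar (hm : ContDiff ℝ ∞ m) (hf : ContDiff ℝ ∞ f) (hq : IsVariation q)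
    (hφ : IsVariation φ) (hψ : IsVariation ψ) (hη : IsVariation η) :
    ∫ p in cell, coeffVar m f q φ ψ η p = pairing (coeffGrad m f q φ ψ) η := by
  have h0 := (hφ.coord 0).mul (hψ.coord 0)
  have hmw := (hq.comp hm).mul (torusFun_wedge hφ hψ)
  have hvmw := (hq.coord 1).mul hmw
  have hη1 := hη.coord 1
  have ha := (TorusFun.const (1 / 2)).mul (h0.mul hη1)
  have hb := hvmw.mul hη1
  refine integral_eq_of_sub_eq_pd
    (torusFun_sum_mul (isVariation_coeffGrad hm hf hq hφ hψ) hη) (hmw.mul hη1) (ha.add hb)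
    fun p => ?_
  rw [pd_mul hmw.1 hη1.1, pd_add ha.1 hb.1, pd_const_mul (h0.mul hη1).1, pd_mul h0.1 hη1.1,
    pd_mul hvmw.1 hη1.1]
  simp only [coeffVar, offDiagVar, coeffGrad, Fin.sum_univ_two, Matrix.cons_val_zero,
    Matrix.cons_val_one, transport]
  rw [fderiv_state_apply f, fderiv_state_apply m]
  ring

/-- The cyclic sum of the coefficient variations is a total derivative plus
`(f_u + m_u (v_x + v v_y) - m h)` times the cyclic sum of `(D χ₀) (φ₀ ψ₁ - φ₁ ψ₀)`; the first
factor is `f_u - m f` if `m_u = m²`. -/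
lemma integral_cyclic_coeffVar (hm : ContDiff ℝ ∞ m) (hf : ContDiff ℝ ∞ f) (hq : IsVariation q)
    (hφ : IsVariation φ) (hψ : IsVariation ψ) (hχ : IsVariation χ)
    (hmu : ∀ p, fderiv ℝ m (q p) (Pi.single 0 1) = m (q p) ^ 2) :
    ((∫ p in cell, coeffVar m f q φ ψ ((hydroOp m f).app q χ) p)
      + ∫ p in cell, coeffVar m f q ψ χ ((hydroOp m f).app q φ) p)
      + ∫ p in cell, coeffVar m f q χ φ ((hydroOp m f).app q ψ) p
    = ∫ p in cell, (fderiv ℝ f (q p) (Pi.single 0 1) - m (q p) * f (q p)) *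
        (transport q (fun p => χ p 0) p * wedge φ ψ p + transport q (fun p => φ p 0) p * wedge ψ χ p
          + transport q (fun p => ψ p 0) p * wedge χ φ p) := by
  have ho := torusFun_offDiag hm hf hq
  have t : ∀ {φ ψ χ}, IsVariation φ → IsVariation ψ → IsVariation χ →
      TorusFun (coeffVar m f q φ ψ ((hydroOp m f).app q χ)) := fun hφ hψ hχ =>
    torusFun_coeffVar hm hf hq hφ hψ (isVariation_app hm hf hq hχ)
  have t' : ∀ {φ ψ χ : Profile 2}, IsVariation φ → IsVariation ψ → IsVariation χ →
      TorusFun (fun p => transport q (fun p => χ p 0) p * wedge φ ψ p) := fun hφ hψ hχ =>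
    (torusFun_transport hq (hχ.coord 0)).mul (torusFun_wedge hφ hψ)
  rw [← integral_add (t hφ hψ hχ).integrableOn (t hψ hχ hφ).integrableOn,
    ← integral_add ((t hφ hψ hχ).add (t hψ hχ hφ)).integrableOn (t hχ hφ hψ).integrableOn]
  have hc := (ho.mul (hχ.coord 0)).mul ((hφ.coord 0).mul (hψ.coord 0))
  refine integral_eq_of_sub_eq_pd
    (((hq.fderiv_apply hf (isVariation_const _)).sub ((hq.comp hm).mul (hq.comp hf))).mul
      (((t' hφ hψ hχ).add (t' hψ hχ hφ)).add (t' hχ hφ hψ))) (TorusFun.const 0)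
    -- the terms without a `wedge` add up to `-(3/2) ∂_y (h φ₀ ψ₀ χ₀)`
    ((TorusFun.const (-(3 / 2))).mul hc) fun p => ?_
  have hη : ∀ {χ : Profile 2}, IsVariation χ → ∀ α,
      pd α (fun p => (hydroOp m f).app q χ p 1) p
        = -(pd α (offDiag m f q) p * χ p 0 + offDiag m f q p * pd α (fun p => χ p 0) p) := by
    intro χ hχ α
    simp only [hydroOp_app_one]
    rw [pd_neg, pd_mul ho.1 (hχ.coord 0).1]
  rw [pd_const, pd_const_mul hc.1, pd_mul (ho.mul (hχ.coord 0)).1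
    ((hφ.coord 0).mul (hψ.coord 0)).1, pd_mul ho.1 (hχ.coord 0).1,
    pd_mul (hφ.coord 0).1 (hψ.coord 0).1]
  simp only [coeffVar, offDiagVar]
  simp only [fderiv_state_apply f (q p) ((hydroOp m f).app q _ p),
    fderiv_state_apply m (q p) ((hydroOp m f).app q _ p)]
  simp only [transport, hη hφ, hη hψ, hη hχ]
  simp only [hydroOp_app_one, hydroOp_app_zero, hmu, wedge, transport]
  have hoe : offDiag m f q p = f (q p) + m (q p) * (pd 0 (fun p => q p 1) p
      + q p 1 * pd 1 (fun p => q p 1) p) := rfl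
  generalize hA : pd 0 (fun p => q p 1) p + q p 1 * pd 1 (fun p => q p 1) p = A at *
  have hff : f (q p) = offDiag m f q p - m (q p) * A := by rw [hoe]; ring
  rw [hff]
  ring

end Smooth

/-! ### The Jacobi identity -/

section Jacobi

variable {m f : State 2 → ℝ} {q : Profile 2}

/-- The variational derivative of the bracket of two functionals with gradients. -/
lemma hasVarDeriv_bracket {W : Set (State 2)} (hW : IsOpen W) (hm : ContDiff ℝ ∞ m)
    (hf : ContDiff ℝ ∞ f) {E₁ E₂ : Profile 2 → Profile 2} (h₁ : IsGradient E₁)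
    (h₂ : IsGradient E₂) {K : Functional 2}
    (hK : ∀ q, IsField W q → K q = pairing (E₁ q) ((hydroOp m f).app q (E₂ q)))
    (hq : IsField W q) :
    HasVarDeriv K q (fun p i =>
      linearization E₁ q ((hydroOp m f).app q (E₂ q)) p i
        - linearization E₂ q ((hydroOp m f).app q (E₁ q)) p i
        + coeffGrad m f q (E₁ q) (E₂ q) p i) := by
  have hv := hq.isVariation
  have hE₁ := h₁.isVariation hv
  have hE₂ := h₂.isVariation hv
  have hP₁ := isVariation_app hm hf hv hE₁
  have hP₂ := isVariation_app hm hf hv hE₂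
  have hl₁ := h₁.linearization hv hP₂
  have hl₂ := h₂.linearization hv hP₁
  have hT := isVariation_coeffGrad hm hf hv hE₁ hE₂
  refine ⟨isVariation_iff.2 fun i => ((hl₁.coord i).sub (hl₂.coord i)).add (hT.coord i),
    fun η hη => ?_⟩
  refine ((hasDerivAt_pairing_app hm hf h₁ h₂ hv hη).congr_deriv ?_).congr_of_eventuallyEq ?_
  · rw [integral_coeffVar hm hf hv hE₁ hE₂ hη]
    simp only [pairing]
    rw [h₁.symm hv hη hP₂, h₂.symm hv hη hP₁, ← integral_sub (torusFun_sum_mul hl₁ hη).integrableOn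
      (torusFun_sum_mul hl₂ hη).integrableOn, ← integral_add
      ((torusFun_sum_mul hl₁ hη).sub (torusFun_sum_mul hl₂ hη)).integrableOn
      (torusFun_sum_mul hT hη).integrableOn]
    congr 1
    funext p
    rw [← Finset.sum_sub_distrib, ← Finset.sum_add_distrib]
    exact Finset.sum_congr rfl fun i _ => by ring
  · filter_upwards [hq.eventually_add_smul hW hη] with s hs
    exact hK _ hs

lemma bracket_bracket_eq {W : Set (State 2)} (hW : IsOpen W) (hm : ContDiff ℝ ∞ m)
    (hf : ContDiff ℝ ∞ f) {E₁ E₂ : Profile 2 → Profile 2} (h₁ : IsGradient E₁)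
    (h₂ : IsGradient E₂) {P : Operator 2}
    (hP : ∀ q ψ, IsField W q → P.app q ψ = (hydroOp m f).app q ψ) {F G H : Functional 2}
    (hF : ∀ q, IsField W q → HasVarDeriv F q (E₁ q))
    (hG : ∀ q, IsField W q → HasVarDeriv G q (E₂ q)) {χ : Profile 2} (hH : HasVarDeriv H q χ)
    (hq : IsField W q) :
    bracket P (bracket P F G) H q
      = pairing (linearization E₁ q ((hydroOp m f).app q (E₂ q))) ((hydroOp m f).app q χ)
        - pairing (linearization E₂ q ((hydroOp m f).app q (E₁ q))) ((hydroOp m f).app q χ)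
        + ∫ p in cell, coeffVar m f q (E₁ q) (E₂ q) ((hydroOp m f).app q χ) p := by
  have hK : ∀ q, IsField W q →
      bracket P F G q = pairing (E₁ q) ((hydroOp m f).app q (E₂ q)) := fun q hq => by
    rw [bracket_eq_pairing, (hF q hq).varDeriv_eq, (hG q hq).varDeriv_eq, hP q _ hq]
  have hv := hq.isVariation
  have hE₁ := h₁.isVariation hv
  have hE₂ := h₂.isVariation hv
  have hP₁ := isVariation_app hm hf hv hE₁
  have hP₂ := isVariation_app hm hf hv hE₂
  have hχ := isVariation_app hm hf hv hH.1
  have t₁ := torusFun_sum_mul (h₁.linearization hv hP₂) hχ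
  have t₂ := torusFun_sum_mul (h₂.linearization hv hP₁) hχ
  have hT := isVariation_coeffGrad hm hf hv hE₁ hE₂
  rw [bracket_eq_pairing, (hasVarDeriv_bracket hW hm hf h₁ h₂ hK hq).varDeriv_eq,
    hH.varDeriv_eq, hP q _ hq, integral_coeffVar hm hf hv hE₁ hE₂ hχ]
  simp only [pairing]
  rw [← integral_sub t₁.integrableOn t₂.integrableOn, ← integral_add
    (t₁.sub t₂).integrableOn (torusFun_sum_mul hT hχ).integrableOn]
  congr 1
  funext p
  rw [← Finset.sum_sub_distrib, ← Finset.sum_add_distrib]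
  exact Finset.sum_congr rfl fun i _ => by ring

/-- Brackets of local functionals are skew-symmetric, and their Jacobiator is given by an explicit
integral: the second variations cancel, because they are symmetric and the operator is
skew-symmetric. -/
lemma bracket_skew_and_jacobi {U : Set (State 2)} (hU : IsOpen U) (hm : ContDiffOn ℝ ∞ m U)
    (hf : ContDiffOn ℝ ∞ f U) (hmu : ∀ s ∈ U, fderiv ℝ m s (Pi.single 0 1) = m s ^ 2)
    {F G H : Functional 2} (hF : IsLocal U F) (hG : IsLocal U G) (hH : IsLocal U H)
    (hq : IsField U q) :
    bracket (hydroOp m f) F G q = -bracket (hydroOp m f) G F q ∧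
    bracket (hydroOp m f) (bracket (hydroOp m f) F G) H q
      + bracket (hydroOp m f) (bracket (hydroOp m f) G H) F q
      + bracket (hydroOp m f) (bracket (hydroOp m f) H F) G q
    = ∫ p in cell, (fderiv ℝ f (q p) (Pi.single 0 1) - m (q p) * f (q p)) *
        (transport q (fun p => varDeriv H q p 0) p * wedge (varDeriv F q) (varDeriv G q) p
          + transport q (fun p => varDeriv F q p 0) p * wedge (varDeriv G q) (varDeriv H q) p
          + transport q (fun p => varDeriv G q p 0) p *
            wedge (varDeriv H q) (varDeriv F q) p) := by
  obtain ⟨c, W, hc, hcU, hW, hqW, hc1⟩ := hq.exists_cutoff hU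
  obtain ⟨E₁, h₁, hF'⟩ := hF.exists_gradient hU hW hc hcU hc1
  obtain ⟨E₂, h₂, hG'⟩ := hG.exists_gradient hU hW hc hcU hc1
  obtain ⟨E₃, h₃, hH'⟩ := hH.exists_gradient hU hW hc hcU hc1
  have hm' := contDiff_cutoff_mul hU hc hcU hm
  have hf' := contDiff_cutoff_mul hU hc hcU hf
  have heq : ∀ (g : State 2 → ℝ), ∀ s ∈ W, c s * g s = g s := fun g s hs => by
    simp [hc1 s hs]
  have hfd : ∀ (g : State 2 → ℝ) (p : Plane),
      fderiv ℝ (fun s => c s * g s) (q p) = fderiv ℝ g (q p) := fun g p =>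
    Filter.EventuallyEq.fderiv_eq (eventually_of_mem (hW.mem_nhds (hqW.2.2 p)) (heq g))
  have hP : ∀ q ψ, IsField W q → (hydroOp m f).app q ψ
      = (hydroOp (fun s => c s * m s) (fun s => c s * f s)).app q ψ := fun q ψ hq =>
    hydroOp_app_congr (fun p => (heq m _ (hq.2.2 p)).symm) (fun p => (heq f _ (hq.2.2 p)).symm) ψ
  have hv := hq.isVariation
  have hE₁ := h₁.isVariation hv
  have hE₂ := h₂.isVariation hv
  have hE₃ := h₃.isVariation hv
  have hP₁ := isVariation_app hm' hf' hv hE₁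
  have hP₂ := isVariation_app hm' hf' hv hE₂
  have hP₃ := isVariation_app hm' hf' hv hE₃
  constructor
  · rw [bracket_eq_pairing, bracket_eq_pairing, (hF' q hqW).varDeriv_eq, (hG' q hqW).varDeriv_eq,
      hP q _ hqW, hP q _ hqW, pairing_app_skew hm' hf' hv hE₁ hE₂]
  rw [bracket_bracket_eq hW hm' hf' h₁ h₂ hP hF' hG' (hH' q hqW) hqW,
    bracket_bracket_eq hW hm' hf' h₂ h₃ hP hG' hH' (hF' q hqW) hqW,
    bracket_bracket_eq hW hm' hf' h₃ h₁ hP hH' hF' (hG' q hqW) hqW,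
    (hF' q hqW).varDeriv_eq, (hG' q hqW).varDeriv_eq, (hH' q hqW).varDeriv_eq]
  have hcyc := integral_cyclic_coeffVar hm' hf' hv hE₁ hE₂ hE₃ (fun p => by
    rw [hfd m p, hmu _ (hq.2.2 p), heq m _ (hqW.2.2 p)])
  have s₁ := h₁.symm hv hP₂ hP₃
  have s₂ := h₂.symm hv hP₁ hP₃
  have s₃ := h₃.symm hv hP₁ hP₂
  have hR : ∀ p, (fderiv ℝ (fun s => c s * f s) (q p) (Pi.single 0 1)
      - c (q p) * m (q p) * (c (q p) * f (q p)))
      = fderiv ℝ f (q p) (Pi.single 0 1) - m (q p) * f (q p) := fun p => by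
    rw [hfd f p, heq m _ (hqW.2.2 p), heq f _ (hqW.2.2 p)]
  simp only [hR] at hcyc
  rw [← hcyc]
  simp only [pairing]
  linarith

/-- The linear functional `q ↦ ∫ φ · q`. -/
def linearFunctional (φ : Profile 2) : Functional 2 := fun q => pairing φ q

lemma isLocal_linearFunctional (U : Set (State 2)) {φ : Profile 2} (hφ : IsVariation φ) :
    IsLocal U (linearFunctional φ) := by
  refine ⟨0, fun z => ∑ i, φ z.1 i * z.2 i 0 0, ContDiff.contDiffOn ?_, fun α p J => ?_,
    fun q _ => rfl⟩
  · refine ContDiff.sum fun i _ => ((hφ.coord i).1.comp contDiff_fst).mul ?_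
    fun_prop
  · simp only [hφ.2 α p]

lemma varDeriv_linearFunctional {φ : Profile 2} (hφ : IsVariation φ) (hq : IsVariation q) :
    varDeriv (linearFunctional φ) q = φ := by
  refine HasVarDeriv.varDeriv_eq ⟨hφ, fun η hη => ?_⟩
  have e : ∀ s : ℝ, linearFunctional φ (q + s • η) = pairing φ q + s * pairing φ η := fun s => by
    simp only [linearFunctional, pairing]
    rw [← integral_const_mul, ← integral_add (torusFun_sum_mul hφ hq).integrableOn
      ((TorusFun.const s).mul (torusFun_sum_mul hφ hη)).integrableOn]
    congr 1
    funext p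
    rw [Finset.mul_sum, ← Finset.sum_add_distrib]
    exact Finset.sum_congr rfl fun i _ => by simp; ring
  have h : HasDerivAt (fun s : ℝ => pairing φ q + s * pairing φ η) (pairing φ η) 0 := by
    simpa using ((hasDerivAt_id (0 : ℝ)).mul_const (pairing φ η)).const_add (pairing φ q)
  exact h.congr_of_eventuallyEq (Eventually.of_forall e)

/-- The function `sin (2 π x)`. -/
def sineWave : Plane → ℝ := fun p => Real.sin (2 * Real.pi * p 0)

lemma torusFun_sineWave : TorusFun sineWave := by
  refine ⟨by unfold sineWave; fun_prop, fun α p => ?_⟩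
  fin_cases α
  · simp [sineWave, mul_add, Real.sin_add_two_pi]
  · simp [sineWave]

lemma pd_sineWave (α : Fin 2) (p : Plane) : pd α sineWave p =
    2 * Real.pi * Real.cos (2 * Real.pi * p 0) * (Pi.single α 1 : Plane) 0 := by
  have h1 : HasFDerivAt (fun p : Plane => 2 * Real.pi * p 0)
      ((2 * Real.pi) • ContinuousLinearMap.proj (R := ℝ) (φ := fun _ : Fin 2 => ℝ) 0) p :=
    (ContinuousLinearMap.proj (R := ℝ) (φ := fun _ : Fin 2 => ℝ) 0).hasFDerivAt.const_mul _
  simp only [pd]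
  rw [show sineWave = fun p => Real.sin (2 * Real.pi * p 0) from rfl, h1.sin.fderiv]
  simp
  ring

/-- The operator is Hamiltonian if and only if `f_u = m f`, provided that `m_u = m²`. For the
converse it suffices to test constant fields and linear functionals. -/
theorem isHamiltonian_hydroOp_iff {U : Set (State 2)} (hU : IsOpen U) (hm : ContDiffOn ℝ ∞ m U)
    (hf : ContDiffOn ℝ ∞ f U) (hmu : ∀ s ∈ U, fderiv ℝ m s (Pi.single 0 1) = m s ^ 2) :
    IsHamiltonian U (hydroOp m f) ↔ ∀ s ∈ U, fderiv ℝ f s (Pi.single 0 1) = m s * f s := by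
  constructor
  · intro h s hs
    have hq : IsField U (fun _ => s) := ⟨contDiff_const, fun _ _ => rfl, fun _ => hs⟩
    have hw := torusFun_sineWave
    have hφ : IsVariation (fun _ => ![1, 0] : Profile 2) := isVariation_const _
    have hψ : IsVariation (fun p => ![0, pd 0 sineWave p] : Profile 2) := by
      refine isVariation_iff.2 fun i => ?_
      fin_cases i
      exacts [TorusFun.const 0, hw.pd 0]
    have hχ : IsVariation (fun p => ![sineWave p, 0] : Profile 2) := by
      refine isVariation_iff.2 fun i => ?_
      fin_cases i
      exacts [hw, TorusFun.const 0]
    have hFl := isLocal_linearFunctional U hφ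
    have hGl := isLocal_linearFunctional U hψ
    have hHl := isLocal_linearFunctional U hχ
    have hJ := (bracket_skew_and_jacobi hU hm hf hmu hFl hGl hHl hq).2
    rw [h.2 _ _ _ hFl hGl hHl _ hq, varDeriv_linearFunctional hφ hq.isVariation,
      varDeriv_linearFunctional hψ hq.isVariation, varDeriv_linearFunctional hχ hq.isVariation]
      at hJ
    simp only [wedge, transport, Matrix.cons_val_zero, Matrix.cons_val_one, pd_const] at hJ
    change 0 = ∫ p in cell, (_ : ℝ) * ((pd 0 sineWave p + s 1 * pd 1 sineWave p) * _ + _ + _) at hJ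
    have e1 : ∀ p, pd 1 sineWave p = 0 := fun p => by simp [pd_sineWave]
    simp only [e1] at hJ
    rw [integral_const_mul] at hJ
    by_contra hne
    have h0 := (mul_eq_zero.1 hJ.symm).resolve_left (sub_ne_zero.2 hne)
    have hz := ((hw.pd 0).mul (hw.pd 0)).eq_zero_of_integral (fun p => mul_self_nonneg _) (by
      rw [← h0]
      congr 1
      funext p
      ring) 0
    have := mul_self_eq_zero.1 hz
    rw [pd_sineWave] at this
    simp [Real.pi_ne_zero] at this
  · intro h
    refine ⟨fun F G hF hG q hq => (bracket_skew_and_jacobi hU hm hf hmu hF hG hG hq).1,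
      fun F G H hF hG hH q hq => ?_⟩
    rw [(bracket_skew_and_jacobi hU hm hf hmu hF hG hH hq).2]
    simp only [fun p => sub_eq_zero.2 (h (q p) (hq.2.2 p)), zero_mul, integral_zero]

end Jacobi

/-! ### Functions that do not depend on the first variable -/

lemma state_eta (s : State 2) : ![s 0, s 1] = s := by
  funext i; fin_cases i <;> rfl

/-- A smooth function whose derivative along `u` vanishes is a smooth function of `v`, if the
slices `v = c` of its domain are connected. -/
lemma exists_eq_comp_snd_iff {U : Set (State 2)} (hU : IsOpen U)
    (hfib : ∀ c : ℝ, IsPreconnected {t : ℝ | ![t, c] ∈ U}) {g : State 2 → ℝ}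
    (hg : ContDiffOn ℝ ∞ g U) :
    (∀ s ∈ U, fderiv ℝ g s (Pi.single 0 1) = 0) ↔
      ∃ F : ℝ → ℝ, ContDiffOn ℝ ∞ F {c | ∃ t, ![t, c] ∈ U} ∧ ∀ s ∈ U, g s = F (s 1) := by
  have hline : ∀ t c : ℝ, HasDerivAt (fun t : ℝ => (![t, c] : State 2)) (Pi.single 0 1) t := by
    intro t c
    refine hasDerivAt_pi.2 fun i => ?_
    fin_cases i
    · simpa using hasDerivAt_id' t
    · simpa using hasDerivAt_const t c
  have hdiff : ∀ s ∈ U, DifferentiableAt ℝ g s := fun s hs =>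
    (hg.contDiffAt (hU.mem_nhds hs)).differentiableAt (by simp)
  have hd : ∀ t c : ℝ, ![t, c] ∈ U →
      HasDerivAt (fun t : ℝ => g ![t, c]) (fderiv ℝ g ![t, c] (Pi.single 0 1)) t :=
    fun t c h => (hdiff _ h).hasFDerivAt.comp_hasDerivAt t (hline t c)
  have hopen : ∀ c : ℝ, IsOpen {t : ℝ | ![t, c] ∈ U} := fun c =>
    hU.preimage (continuous_iff_continuousAt.2 fun t => (hline t c).continuousAt)
  constructor
  · intro h
    have hconst : ∀ c t t' : ℝ, ![t, c] ∈ U → ![t', c] ∈ U → g ![t, c] = g ![t', c] := by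
      intro c t t' ht ht'
      exact (hopen c).is_const_of_deriv_eq_zero (hfib c)
        (fun x hx => (hd x c hx).differentiableAt.differentiableWithinAt)
        (fun x hx => by rw [(hd x c hx).deriv, h _ hx, Pi.zero_apply]) ht ht'
    classical
    set F : ℝ → ℝ := fun c => if hc : ∃ t, ![t, c] ∈ U then g ![hc.choose, c] else 0 with hF
    have hFg : ∀ t c : ℝ, ![t, c] ∈ U → F c = g ![t, c] := fun t c ht => by
      have hc : ∃ t, ![t, c] ∈ U := ⟨t, ht⟩
      simp only [hF, dif_pos hc]
      exact hconst c _ _ hc.choose_spec ht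
    refine ⟨F, ?_, fun s hs => ?_⟩
    · rintro c ⟨t, ht⟩
      -- near `c` the function `F` is `g` along the line `u = t`
      have hl : ContDiff ℝ ∞ (fun c : ℝ => (![t, c] : State 2)) := by
        refine contDiff_pi.2 fun i => ?_
        fin_cases i
        exacts [contDiff_const, contDiff_id]
      have hgc : ContDiffAt ℝ ∞ (fun c : ℝ => g ![t, c]) c :=
        (hg.contDiffAt (hU.mem_nhds ht)).comp c hl.contDiffAt
      refine (hgc.congr_of_eventuallyEq ?_).contDiffWithinAt
      filter_upwards [(hU.preimage hl.continuous).mem_nhds ht] with c' hc'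
      exact hFg t c' hc'
    · rw [hFg (s 0) (s 1) (by rwa [state_eta]), state_eta]
  · rintro ⟨F, -, hF⟩ s hs
    have hs' : ![s 0, s 1] ∈ U := by rwa [state_eta]
    have h1 := hd (s 0) (s 1) hs'
    rw [state_eta] at h1
    refine h1.unique ((hasDerivAt_const (s 0) (F (s 1))).congr_of_eventuallyEq ?_)
    filter_upwards [(hopen (s 1)).mem_nhds hs'] with t ht
    exact hF _ ht

end HydroHam

end

open HydroHam in
theorem theorem4 (U : Set (State 2)) (hU : IsOpen U)
    (hfib : ∀ c : ℝ, IsPreconnected {t : ℝ | ![t, c] ∈ U})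
    (f : State 2 → ℝ) (hf : ContDiffOn ℝ ∞ f U) :
    (IsHamiltonian U (P₁.addUltralocal (ultralocal f)) ↔
      ∃ F : ℝ → ℝ, ContDiffOn ℝ ∞ F {c | ∃ t, ![t, c] ∈ U} ∧
        ∀ s ∈ U, f s = F (s 1)) ∧
    ((∀ s ∈ U, s 0 ≠ 0) →
      (IsHamiltonian U (P₂.addUltralocal (ultralocal f)) ↔
        ∃ F : ℝ → ℝ, ContDiffOn ℝ ∞ F {c | ∃ t, ![t, c] ∈ U} ∧
          ∀ s ∈ U, f s = F (s 1) / s 0)) := by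
  constructor
  · rw [P₁_addUltralocal, isHamiltonian_hydroOp_iff hU contDiffOn_const hf (by simp),
      ← exists_eq_comp_snd_iff hU hfib hf]
    simp only [zero_mul]
  · intro h0
    have hu : ContDiff ℝ ∞ (fun s : State 2 => s 0) := by fun_prop
    have hm : ContDiffOn ℝ ∞ (fun s : State 2 => -(1 / s 0)) U :=
      (contDiffOn_const.div hu.contDiffOn h0).neg
    have hud : ∀ s : State 2, HasFDerivAt (fun s : State 2 => s 0)
        (ContinuousLinearMap.proj (R := ℝ) (φ := fun _ : Fin 2 => ℝ) 0) s := fun s =>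
      (ContinuousLinearMap.proj (R := ℝ) (φ := fun _ : Fin 2 => ℝ) 0).hasFDerivAt
    have hmu : ∀ s ∈ U, fderiv ℝ (fun s : State 2 => -(1 / s 0)) s (Pi.single 0 1)
        = (-(1 / s 0)) ^ 2 := fun s hs => by
      have h := ((hasDerivAt_inv (h0 s hs)).comp_hasFDerivAt s (hud s)).neg
      have e : (fun s : State 2 => -(1 / s 0)) = -((fun x : ℝ => x⁻¹) ∘ fun s : State 2 => s 0) := by
        funext s; simp
      rw [e, h.fderiv]
      simp
    rw [P₂_addUltralocal, isHamiltonian_hydroOp_iff hU hm hf hmu]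
    -- `f_u = -f / u` means that `u f` does not depend on `u`
    have hprod : ∀ s ∈ U, fderiv ℝ (fun s : State 2 => s 0 * f s) s (Pi.single 0 1)
        = f s + s 0 * fderiv ℝ f s (Pi.single 0 1) := fun s hs => by
      have hfs := ((hf.contDiffAt (hU.mem_nhds hs)).differentiableAt (by simp)).hasFDerivAt
      change fderiv ℝ ((fun s : State 2 => s 0) * f) s _ = _
      rw [((hud s).mul hfs).fderiv]
      simp
      ring
    have key := exists_eq_comp_snd_iff hU hfib (hu.contDiffOn.mul hf)
    have e1 : (∀ s ∈ U, fderiv ℝ f s (Pi.single 0 1) = -(1 / s 0) * f s) ↔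
        ∀ s ∈ U, fderiv ℝ (fun s : State 2 => s 0 * f s) s (Pi.single 0 1) = 0 := by
      refine forall₂_congr fun s hs => ?_
      rw [hprod s hs]
      have hne := h0 s hs
      constructor
      · intro h
        rw [h]
        field_simp
        ring
      · intro h
        field_simp
        linarith
    rw [e1, key]
    refine exists_congr fun F => and_congr_right fun _ => forall₂_congr fun s hs => ?_
    rw [eq_div_iff (h0 s hs), mul_comm]
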